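/- All manifolds are smooth, real and finite-dimensional; principal bundles are smooth with structure group acting from the right. Let $1\to A\xrightarrow{\alpha}B\xrightarrow{\beta}C\to 1$ be a central extension of Lie groups (in particular $\beta\colon B\to C$ is a principal $A$-bundle), with Lie algebras $\mathfrak a,\mathfrak b,\mathfrak c$, and assume that $\beta_*\colon\mathfrak b\to\mathfrak c$ admits an $\mathrm{Ad}|_B$-equivariant linear section $s\colon\mathfrak c\to\mathfrak b$, where $B$ acts on $\mathfrak c$ through $\beta$. Let $t\colon\mathfrak b\to\mathfrak a$ be determined by $1=\alpha_*t+s\beta_*$, and let $\theta_B$ be the (left-invariant) Maurer–Cartan form of $B$. Let $G$ be a Lie group acting smoothly on a manifold $X$ and let $\pi\colon P\to X$ be a $G$-equivariant principal $C$-bundle with a $G$-invariant connection $\omega^\pi$. The difference bundle of $P$ is the $G$-equivariant principal $A$-bundle over $P\times_XP$ given by $Q_P=\{(p_1,p_2,b)\in P\times P\times B:\ \pi(p_1)=\pi(p_2),\ p_1\beta(b)=p_2\}$, with $(p_1,p_2,b)a=(p_1,p_2,b\,\alpha(a))$, $g(p_1,p_2,b)=(gp_1,gp_2,b)$, multiplication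 $m\big((p_1,p_2,b),(p_2,p_3,b')\big)=(p_1,p_3,bb')$, and with the connection $\omega^{Q_P}$ obtained by pulling back $t\circ\theta_B$ (the connection on $\beta\colon B\to C$ given by $s$) along the projection $Q_P\to B$. A $G$-equivariant central extension of $\pi$ with admissible connection consists of a $G$-equivariant principal $B$-bundle $\rho\colon R\to X$, a smooth $G$-equivariant map $\sigma\colon R\to P$ with $\pi\sigma=\rho$ and $\sigma(rb)=\sigma(r)\beta(b)$, and a $G$-invariant connection $\omega^\rho$ on $\rho$ with $\beta_*(\omega^\rho)=\sigma^*\omega^\pi$. An isomorphism of two of them is a $B$- and $G$-equivariant diffeomorphism of the total spaces that commutes with the maps to $P$ and preserves the connections. A triple $(\sigma,\omega^\sigma,\psi)$ consists of a $G$-equivariant principal $A$-bundle $\sigma\colon R\to P$, a $G$-invariant connection $\omega^\sigma$ on it, and a smooth $G$-equivariant $A$-homomorphism $\psi\colon R\times^AR\to Q_P$ over $P\times_XP$, such that $$m\big(\psi[r_1,r_2],\psi[r_2,r_3]\big)=\psi[r_1,r_3]\quad\text{for all }(r_1,r_2,r_3)\in R\times_XR\times_XR,$$ $$\mathrm{pr}_2^*\omega^\sigma-\mathrm{pr}_1^*\omega^\sigma=\psi^*\omega^{Q_P}\quad\text{on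 }R\times_XR .$$ Here $R\times^AR$ is the quotient of $R\times_XR$ by the diagonal action $(r_1,r_2)\mapsto(r_1a,r_2a)$, with $A$-action $[r_1,r_2]a=[r_1,r_2a]$ and $G$-action $g[r_1,r_2]=[gr_1,gr_2]$. An isomorphism of triples is an $A$- and $G$-equivariant diffeomorphism $\Phi$ of the total spaces that commutes with the maps to $P$, preserves the connections and satisfies $\psi'[\Phi r_1,\Phi r_2]=\psi[r_1,r_2]$. Then there is a bijection between the isomorphism classes of $G$-equivariant central extensions of $\pi$ with admissible $G$-invariant connection and the isomorphism classes of triples $(\sigma,\omega^\sigma,\psi)$. Under it, the class of $(\rho,\sigma,\omega^\rho)$ with total space $R$ corresponds to the class of a triple precisely if that triple is, up to isomorphism, the following one on the same total space: $\sigma\colon R\to P$ with $A$ acting on $R$ through $\alpha$, the connection $\omega^\sigma=t\circ\omega^\rho$, and $\psi[r_1,r_2]=(\sigma(r_1),\sigma(r_2),b)$ with $r_1b=r_2$. -/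

import Mathlib

open scoped Manifold ContDiff RightActions

noncomputable section

/-! ### Lie groups: adjoint action and Maurer-Cartan form

All manifolds are smooth real manifolds without boundary, modelled on a normed space `E` through
`𝓘(ℝ, E)`.  The Lie algebra of `K` is `GroupLieAlgebra 𝓘(ℝ, EK) K`, the tangent space at `1`. -/

section LieGroups

variable (EK K : Type*) [NormedAddCommGroup EK] [NormedSpace ℝ EK]
  [TopologicalSpace K] [ChartedSpace EK K] [Group K]

/-- The adjoint action `Ad k : 𝔨 → 𝔨`, i.e. `ξ ↦ k ξ k⁻¹`: the differential at `1` of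
conjugation by `k`. -/
def lieAd (k : K) : GroupLieAlgebra 𝓘(ℝ, EK) K →L[ℝ] GroupLieAlgebra 𝓘(ℝ, EK) K :=
  mfderiv 𝓘(ℝ, EK) 𝓘(ℝ, EK) (fun x : K => k * x * k⁻¹) 1

/-- The (left-invariant) Maurer-Cartan form `θ(ξ) = k⁻¹ ξ` for `ξ ∈ T_k K`. -/
def maurerCartan (k : K) : TangentSpace 𝓘(ℝ, EK) k →L[ℝ] GroupLieAlgebra 𝓘(ℝ, EK) K :=
  mfderiv 𝓘(ℝ, EK) 𝓘(ℝ, EK) (fun x : K => k⁻¹ * x) k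

/-- The identification of `𝔨 = T_1 K` with the model space `EK`, used to speak of smooth
`𝔨`-valued functions. -/
def lieToModel (ξ : GroupLieAlgebra 𝓘(ℝ, EK) K) : EK := ξ

end LieGroups

/-! ### Principal bundles, equivariant bundles and equivariant connections -/

section Bundles

variable (EG G EK K EM M EX X : Type*)
  [NormedAddCommGroup EG] [NormedSpace ℝ EG] [TopologicalSpace G] [ChartedSpace EG G] [Group G]
  [NormedAddCommGroup EK] [NormedSpace ℝ EK] [TopologicalSpace K] [ChartedSpace EK K] [Group K]
  [NormedAddCommGroup EM] [NormedSpace ℝ EM] [TopologicalSpace M] [ChartedSpace EM M]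
  [NormedAddCommGroup EX] [NormedSpace ℝ EX] [TopologicalSpace X] [ChartedSpace EX X]

/-- `π : M → X` is a smooth principal `K`-bundle: `K` acts smoothly on `M` from the right (written
`p <• k`), `π` is invariant, and every point of `X` has an open neighbourhood `U` with a
`K`-equivariant diffeomorphism `e : π⁻¹(U) ≅ U × K` over `U`. -/
structure IsPrincipalBundle [MulAction Kᵐᵒᵖ M] (π : M → X) : Prop where
  contMDiff_act : ContMDiff (𝓘(ℝ, EM).prod 𝓘(ℝ, EK)) 𝓘(ℝ, EM) ∞ (fun z : M × K => z.1 <• z.2)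
  map_act : ∀ (p : M) (k : K), π (p <• k) = π p
  locally_trivial : ∀ x : X, ∃ U : Set X, IsOpen U ∧ x ∈ U ∧
    ∃ e : OpenPartialHomeomorph M (X × K),
      e.source = π ⁻¹' U ∧ e.target = U ×ˢ Set.univ ∧
      ContMDiffOn 𝓘(ℝ, EM) (𝓘(ℝ, EX).prod 𝓘(ℝ, EK)) ∞ e e.source ∧
      ContMDiffOn (𝓘(ℝ, EX).prod 𝓘(ℝ, EK)) 𝓘(ℝ, EM) ∞ e.symm e.target ∧
      ∀ p ∈ e.source, (e p).1 = π p ∧ ∀ k : K, e (p <• k) = (π p, (e p).2 * k)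

/-- `π : M → X` is a `G`-equivariant principal `K`-bundle. -/
structure IsEquivariantBundle [MulAction Kᵐᵒᵖ M] [MulAction G M] [MulAction G X]
    (π : M → X) : Prop where
  isPrincipalBundle : IsPrincipalBundle EK K EM M EX X π
  contMDiff_smul : ContMDiffSMul 𝓘(ℝ, EG) 𝓘(ℝ, EM) ∞ G M
  smul_act : ∀ (g : G) (p : M) (k : K), g • (p <• k) = (g • p) <• k
  map_smul : ∀ (g : G) (p : M), π (g • p) = g • π p

/-- A `G`-equivariant connection on a `G`-equivariant principal `K`-bundle with total space `M`,
given by its connection form, a smooth `𝔨`-valued `1`-form `ϖ` on `M`.  A `1`-form is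
smooth if it is smooth as a function on the tangent bundle. -/
structure GConnection [IsManifold 𝓘(ℝ, EM) ∞ M] [MulAction Kᵐᵒᵖ M] [MulAction G M] where
  form : ∀ p : M, TangentSpace 𝓘(ℝ, EM) p →L[ℝ] GroupLieAlgebra 𝓘(ℝ, EK) K
  smooth : ContMDiff 𝓘(ℝ, EM).tangent 𝓘(ℝ, EK) ∞
    (fun v : TangentBundle 𝓘(ℝ, EM) M => lieToModel EK K (form v.1 v.2))
  /-- `ϖ(p · ξ) = ξ`, where `p · ξ` is the derivative of `k ↦ p k` at `1` in direction `ξ ∈ 𝔨`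
  (a tangent vector at `p 1 = p`). -/
  vertical : ∀ (p : M) (ξ : GroupLieAlgebra 𝓘(ℝ, EK) K),
    form (p <• (1 : K)) (mfderiv 𝓘(ℝ, EK) 𝓘(ℝ, EM) (fun k : K => p <• k) 1 ξ) = ξ
  /-- `ϖ(v k) = k⁻¹ ϖ(v) k`. -/
  equivariant : ∀ (p : M) (k : K) (v : TangentSpace 𝓘(ℝ, EM) p),
    form (p <• k) (mfderiv 𝓘(ℝ, EM) 𝓘(ℝ, EM) (fun q : M => q <• k) p v)
      = lieAd EK K k⁻¹ (form p v)
  /-- `ϖ(g v) = ϖ(v)`. -/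
  invariant : ∀ (g : G) (p : M) (v : TangentSpace 𝓘(ℝ, EM) p),
    form (g • p) (mfderiv 𝓘(ℝ, EM) 𝓘(ℝ, EM) (fun q : M => g • q) p v) = form p v

end Bundles

/-! ### Central extensions of Lie groups and `Ad`-equivariant splittings -/

section CentralExtensions

variable (EA A EB B EC C : Type*)
  [NormedAddCommGroup EA] [NormedSpace ℝ EA] [TopologicalSpace A] [ChartedSpace EA A] [CommGroup A]
  [NormedAddCommGroup EB] [NormedSpace ℝ EB] [TopologicalSpace B] [ChartedSpace EB B] [Group B]
  [NormedAddCommGroup EC] [NormedSpace ℝ EC] [TopologicalSpace C] [ChartedSpace EC C] [Group C]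

/-- The right action of `A` on a `B`-space obtained by restriction along `α : A → B`. -/
abbrev restrictRightAction {A B R : Type*} [Monoid A] [Monoid B] [MulAction Bᵐᵒᵖ R] (α : A →* B) :
    MulAction Aᵐᵒᵖ R :=
  MulAction.compHom R (MonoidHom.op α)

/-- A central extension of Lie groups `1 → A → B → C → 1`: a short exact sequence of smooth
homomorphisms `α`, `β` with central image of `A`, such that `β : B → C` is a principal `A`-bundle
(for `A` acting on `B` by right multiplication through `α`). -/
structure LieCentralExtension where
  α : A →* B
  β : B →* C
  contMDiff_α : ContMDiff 𝓘(ℝ, EA) 𝓘(ℝ, EB) ∞ α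
  contMDiff_β : ContMDiff 𝓘(ℝ, EB) 𝓘(ℝ, EC) ∞ β
  injective : Function.Injective α
  exact : α.range = β.ker
  surjective : Function.Surjective β
  central : ∀ (a : A) (b : B), α a * b = b * α a
  isPrincipalBundle :
    @IsPrincipalBundle EA A EB B EC C _ _ _ _ _ _ _ _ _ _ _ _ _ (restrictRightAction α) β

namespace LieCentralExtension

variable {EA A EB B EC C}
variable (𝓔 : LieCentralExtension EA A EB B EC C)

/-- `α_* : 𝔞 → 𝔟`. -/
def dα : GroupLieAlgebra 𝓘(ℝ, EA) A →L[ℝ] GroupLieAlgebra 𝓘(ℝ, EB) B :=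
  mfderiv 𝓘(ℝ, EA) 𝓘(ℝ, EB) 𝓔.α 1

/-- `β_* : 𝔟 → 𝔠`. -/
def dβ : GroupLieAlgebra 𝓘(ℝ, EB) B →L[ℝ] GroupLieAlgebra 𝓘(ℝ, EC) C :=
  mfderiv 𝓘(ℝ, EB) 𝓘(ℝ, EC) 𝓔.β 1

/-- An `Ad|_B`-equivariant linear section `s : 𝔠 → 𝔟` of `β_*`, where `B` acts on `𝔠` through
`β`. -/
structure AdSplitting where
  s : GroupLieAlgebra 𝓘(ℝ, EC) C →L[ℝ] GroupLieAlgebra 𝓘(ℝ, EB) B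
  dβ_s : ∀ ξ, 𝓔.dβ (s ξ) = ξ
  equivariant : ∀ (b : B) (ξ), s (lieAd EC C (𝓔.β b) ξ) = lieAd EB B b (s ξ)

variable {𝓔}

/-- The dual projection `t : 𝔟 → 𝔞`, determined by `1 = α_* t + s β_*`. -/
def AdSplitting.t (S : 𝓔.AdSplitting) :
    GroupLieAlgebra 𝓘(ℝ, EB) B →ₗ[ℝ] GroupLieAlgebra 𝓘(ℝ, EA) A :=
  𝓔.dα.toLinearMap.leftInverse ∘ₗ (LinearMap.id - S.s.toLinearMap ∘ₗ 𝓔.dβ.toLinearMap)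

/-- Differentiating the central extension gives `ker α_* = 0` and `ker β_* ⊆ im α_*`. -/
theorem infinitesimal_exactness (𝓔 : LieCentralExtension EA A EB B EC C)
    [LieGroup 𝓘(ℝ, EA) ∞ A] :
    Function.Injective 𝓔.dα ∧ ∀ ξ, 𝓔.dβ ξ = 0 → ∃ η, 𝓔.dα η = ξ := by
  let _ : MulAction Aᵐᵒᵖ B := restrictRightAction 𝓔.α
  obtain ⟨U, hU, h1, e, hs, ht, he, he', heq⟩ := 𝓔.isPrincipalBundle.locally_trivial (𝓔.β 1)
  have hact : ∀ (b : B) (a : A), b <• a = b * 𝓔.α a := fun _ _ => rfl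
  have h1s : (1 : B) ∈ e.source := by rw [hs]; exact h1
  have hβα : ∀ a, 𝓔.β (𝓔.α a) = 1 := fun a => by
    have : 𝓔.α a ∈ 𝓔.β.ker := 𝓔.exact ▸ ⟨a, rfl⟩
    exact this
  set c : A := (e 1).2 with hc
  have he1 : e 1 = (𝓔.β 1, c) := Prod.ext (heq 1 h1s).1 rfl
  have heα : ∀ a, e (𝓔.α a) = (𝓔.β 1, c * a) := fun a => by
    have := (heq 1 h1s).2 a
    rwa [hact, one_mul] at this
  have hαs : ∀ a, 𝓔.α a ∈ e.source := fun a => by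
    rw [hs, Set.mem_preimage, hβα]; simpa using h1
  have hαe : ∀ a, 𝓔.α a = e.symm (𝓔.β 1, c * a) := fun a => by
    rw [← heα, e.left_inv (hαs a)]
  have dL : ∀ (c x : A), MDifferentiableAt 𝓘(ℝ, EA) 𝓘(ℝ, EA) (fun a : A => c * a) x := fun c x =>
    (contMDiff_mul_left (I := 𝓘(ℝ, EA)) (n := ∞) (a := c)).mdifferentiableAt (by simp)
  have de : ∀ b ∈ e.source, MDifferentiableAt 𝓘(ℝ, EB) (𝓘(ℝ, EC).prod 𝓘(ℝ, EA)) e b :=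
    fun b hb => (he.contMDiffAt (e.open_source.mem_nhds hb)).mdifferentiableAt (by simp)
  have h1t : (𝓔.β 1, c) ∈ e.target := he1 ▸ e.map_source h1s
  have des : MDifferentiableAt (𝓘(ℝ, EC).prod 𝓘(ℝ, EA)) 𝓘(ℝ, EB) e.symm (𝓔.β 1, c) :=
    (he'.contMDiffAt (e.open_target.mem_nhds h1t)).mdifferentiableAt (by simp)
  have dα : MDifferentiableAt 𝓘(ℝ, EA) 𝓘(ℝ, EB) 𝓔.α 1 :=
    𝓔.contMDiff_α.contMDiffAt.mdifferentiableAt (by simp)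
  have dβ : MDifferentiableAt 𝓘(ℝ, EB) 𝓘(ℝ, EC) 𝓔.β 1 :=
    𝓔.contMDiff_β.contMDiffAt.mdifferentiableAt (by simp)
  constructor
  · have key : (fun a : A => c⁻¹ * (e (𝓔.α a)).2) = id := by
      ext a; simp [heα]
    have h2 := HasMFDerivAt.comp (g := fun a : A => c⁻¹ * a) (f := fun a => (e (𝓔.α a)).2) 1
      (dL _ _).hasMFDerivAt
      (HasMFDerivAt.comp (g := fun b : B => (e b).2) 1 (de _ (hαs 1)).snd.hasMFDerivAt dα.hasMFDerivAt)
    have h3 : HasMFDerivAt 𝓘(ℝ, EA) 𝓘(ℝ, EA) (fun a : A => c⁻¹ * (e (𝓔.α a)).2) 1 _ := h2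
    rw [key] at h3
    have h4 := hasMFDerivAt_unique h3 (hasMFDerivAt_id 1)
    intro η η' h
    have h5 := congrArg (fun L : EA →L[ℝ] EA => L η) h4
    have h6 := congrArg (fun L : EA →L[ℝ] EA => L η') h4
    have h7 : mfderiv 𝓘(ℝ, EA) 𝓘(ℝ, EB) 𝓔.α 1 η = mfderiv 𝓘(ℝ, EA) 𝓘(ℝ, EB) 𝓔.α 1 η' := h
    refine Eq.trans (b := _) h5.symm (Eq.trans ?_ h6)
    exact congrArg (fun u : EB => (mfderiv 𝓘(ℝ, EA) 𝓘(ℝ, EA) (fun a : A => c⁻¹ * a) (e (𝓔.α 1)).2 : EA →L[ℝ] EA)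
      ((mfderiv 𝓘(ℝ, EB) 𝓘(ℝ, EA) (fun b : B => (e b).2) (𝓔.α 1) : EB →L[ℝ] EA) u)) h7
  · intro ξ hξ
    have dD : ∀ c', c' = c → HasMFDerivAt (𝓘(ℝ, EC).prod 𝓘(ℝ, EA)) 𝓘(ℝ, EB) e.symm (𝓔.β 1, c')
        (show EC × EA →L[ℝ] EB from
          mfderiv (𝓘(ℝ, EC).prod 𝓘(ℝ, EA)) 𝓘(ℝ, EB) e.symm (𝓔.β 1, c)) := by
      rintro _ rfl
      exact des.hasMFDerivAt
    have hid : (fun b => e.symm (𝓔.β b, (e b).2)) =ᶠ[nhds 1] id := by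
      filter_upwards [e.open_source.mem_nhds h1s] with b hb
      have : e b = (𝓔.β b, (e b).2) := Prod.ext (heq b hb).1 rfl
      rw [← this, e.left_inv hb]; rfl
    have g1 := HasMFDerivAt.comp (g := e.symm) (f := fun b => (𝓔.β b, (e b).2)) 1
      (dD _ rfl) (dβ.hasMFDerivAt.prodMk (de _ h1s).snd.hasMFDerivAt)
    have g2 := hasMFDerivAt_unique g1 ((hasMFDerivAt_id (I := 𝓘(ℝ, EB)) (1 : B)).congr_of_eventuallyEq hid)
    have hα' : (𝓔.α : A → B) = fun a => e.symm (𝓔.β 1, c * a) := funext hαe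
    have g3 := HasMFDerivAt.comp (g := e.symm) (f := fun a : A => (𝓔.β 1, c * a)) 1
      (dD _ (mul_one c)) ((hasMFDerivAt_const (𝓔.β 1) 1).prodMk (dL c 1).hasMFDerivAt)
    have g3' : HasMFDerivAt 𝓘(ℝ, EA) 𝓘(ℝ, EB) (fun a => e.symm (𝓔.β 1, c * a)) 1 _ := g3
    rw [← hα'] at g3'
    have g4 := hasMFDerivAt_unique dα.hasMFDerivAt g3'
    have l1 := HasMFDerivAt.comp (g := fun a : A => c * a) (f := fun a : A => c⁻¹ * a) (c * 1)
      (dL c _).hasMFDerivAt (dL c⁻¹ _).hasMFDerivAt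
    have l2 : HasMFDerivAt 𝓘(ℝ, EA) 𝓘(ℝ, EA) (fun a : A => c * (c⁻¹ * a)) (c * 1) _ := l1
    have l3 : (fun a : A => c * (c⁻¹ * a)) = id := by ext; simp
    rw [l3] at l2
    have l4 := hasMFDerivAt_unique l2 (hasMFDerivAt_id (c * 1))
    have aux : ∀ x : A, x = 1 → (mfderiv 𝓘(ℝ, EA) 𝓘(ℝ, EA) (fun a : A => c * a) x : EA →L[ℝ] EA)
      = (mfderiv 𝓘(ℝ, EA) 𝓘(ℝ, EA) (fun a : A => c * a) 1 : EA →L[ℝ] EA) := by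
      rintro _ rfl; rfl
    let w : EA := mfderiv 𝓘(ℝ, EB) 𝓘(ℝ, EA) (fun b => (e b).2) 1 ξ
    let η : EA := (mfderiv 𝓘(ℝ, EA) 𝓘(ℝ, EA) (fun a : A => c⁻¹ * a) (c * 1) : EA →L[ℝ] EA) w
    have hη : (mfderiv 𝓘(ℝ, EA) 𝓘(ℝ, EA) (fun a : A => c * a) 1 : EA →L[ℝ] EA) η = w := by
      have := congrArg (fun L : EA →L[ℝ] EA => L w) l4
      rw [← aux (c⁻¹ * (c * 1)) (by simp)]
      exact this
    refine ⟨η, ?_⟩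
    have r1 := congrArg (fun L : EA →L[ℝ] EB => L η) g4
    have r2 := congrArg (fun L : EB →L[ℝ] EB => L ξ) g2
    refine Eq.trans r1 (Eq.trans ?_ r2)
    have hξ' : (mfderiv 𝓘(ℝ, EB) 𝓘(ℝ, EC) 𝓔.β 1 ξ : EC) = 0 := hξ
    have : ((0 : EC), (mfderiv 𝓘(ℝ, EA) 𝓘(ℝ, EA) (fun a : A => c * a) 1 : EA →L[ℝ] EA) η)
       = ((mfderiv 𝓘(ℝ, EB) 𝓘(ℝ, EC) 𝓔.β 1 ξ : EC), w) := by rw [hη, hξ']; rfl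
    exact congrArg (show EC × EA →L[ℝ] EB from
          mfderiv (𝓘(ℝ, EC).prod 𝓘(ℝ, EA)) 𝓘(ℝ, EB) e.symm (𝓔.β 1, c)) this

/-- The characterization `1 = α_* t + s β_*` of `t`. -/
theorem AdSplitting.dα_t [LieGroup 𝓘(ℝ, EA) ∞ A] (S : 𝓔.AdSplitting) (ξ : GroupLieAlgebra 𝓘(ℝ, EB) B) :
    𝓔.dα (S.t ξ) + S.s (𝓔.dβ ξ) = ξ := by
  obtain ⟨hi, hk⟩ := infinitesimal_exactness 𝓔
  obtain ⟨η, hη⟩ := hk (ξ - S.s (𝓔.dβ ξ)) (by rw [map_sub, S.dβ_s, sub_self])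
  have : S.t ξ = 𝓔.dα.toLinearMap.leftInverse (ξ - S.s (𝓔.dβ ξ)) := rfl
  rw [this, ← hη]
  have := LinearMap.leftInverse_apply_of_inj (f := 𝓔.dα.toLinearMap) (LinearMap.ker_eq_bot.2 hi) η
  erw [this]
  rw [hη, sub_add_cancel]

/-- The section `s`, regarded as a connection on the `A`-bundle `β : B → C`, through its connection
form `t ∘ θ_B`, with kernel `b · s(𝔠)` at `b`. -/
def AdSplitting.connForm (S : 𝓔.AdSplitting) (b : B) :
    TangentSpace 𝓘(ℝ, EB) b →ₗ[ℝ] GroupLieAlgebra 𝓘(ℝ, EA) A :=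
  S.t ∘ₗ (maurerCartan EB B b).toLinearMap

end LieCentralExtension

end CentralExtensions

/-! ### Smooth maps on embedded submanifolds -/

section Submanifolds

variable {EM HM M EN HN N : Type*}
  [NormedAddCommGroup EM] [NormedSpace ℝ EM] [TopologicalSpace HM]
  [TopologicalSpace M] [ChartedSpace HM M]
  [NormedAddCommGroup EN] [NormedSpace ℝ EN] [TopologicalSpace HN]
  [TopologicalSpace N] [ChartedSpace HN N]

/-- `g : M → N` is, on some open neighbourhood of `x`, a smooth extension of the map `f` defined on
the subset `S` of the manifold `M`. -/
def IsLocalSmoothExtension (I : ModelWithCorners ℝ EM HM) (J : ModelWithCorners ℝ EN HN)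
    {S : Set M} (f : S → N) (x : S) (g : M → N) : Prop :=
  ∃ U : Set M, IsOpen U ∧ (x : M) ∈ U ∧ ContMDiffOn I J ∞ g U ∧ ∀ y : S, (y : M) ∈ U → g y = f y

/-- A map on a subset `S` of a manifold is smooth if it extends smoothly to the ambient manifold
near every point of `S`.  For embedded submanifolds this is smoothness in the usual sense, and the
differential of `f` on a vector tangent to `S` is that of any local smooth extension. -/
def SmoothOnSubset (I : ModelWithCorners ℝ EM HM) (J : ModelWithCorners ℝ EN HN)
    {S : Set M} (f : S → N) : Prop :=
  ∀ x : S, ∃ g : M → N, IsLocalSmoothExtension I J f x g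

end Submanifolds

/-! ### The difference bundle `Q_P` and the bundle `R ×^A R` -/

section DifferenceBundle

variable {EG G EA A EB B EC C EX X EP P : Type*}
  [NormedAddCommGroup EG] [NormedSpace ℝ EG] [TopologicalSpace G] [ChartedSpace EG G] [Group G]
  [NormedAddCommGroup EA] [NormedSpace ℝ EA] [TopologicalSpace A] [ChartedSpace EA A] [CommGroup A]
  [NormedAddCommGroup EB] [NormedSpace ℝ EB] [TopologicalSpace B] [ChartedSpace EB B] [Group B]
  [NormedAddCommGroup EC] [NormedSpace ℝ EC] [TopologicalSpace C] [ChartedSpace EC C] [Group C]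
  [NormedAddCommGroup EX] [NormedSpace ℝ EX] [TopologicalSpace X] [ChartedSpace EX X]
  [NormedAddCommGroup EP] [NormedSpace ℝ EP] [TopologicalSpace P] [ChartedSpace EP P]
  [MulAction Cᵐᵒᵖ P] [MulAction G X] [MulAction G P]

/-- The difference bundle `Q_P` of a principal `C`-bundle `π : P → X`: the pullback of `β : B → C`
along the difference map `δ_P : P ×_X P → C`, `p₁ δ_P(p₁, p₂) = p₂`.  Its points are triples
`(p₁, p₂, b)` with `(p₁, p₂) ∈ P ×_X P` and `β(b) = δ_P(p₁, p₂)`, i.e. `p₁ β(b) = p₂`; it is an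
embedded submanifold of `P × P × B`. -/
@[ext]
structure DifferenceBundle (𝓔 : LieCentralExtension EA A EB B EC C) (π : P → X) where
  p₁ : P
  p₂ : P
  b : B
  same_fibre : π p₁ = π p₂
  lifts : p₁ <• 𝓔.β b = p₂

namespace DifferenceBundle

variable {𝓔 : LieCentralExtension EA A EB B EC C} {π : P → X}

/-- The inclusion `Q_P ⊆ P × P × B`. -/
def coord (q : DifferenceBundle 𝓔 π) : P × P × B := (q.p₁, q.p₂, q.b)

/-- The right `A`-action `(p₁, p₂, b) a = (p₁, p₂, b a)`. -/
def act (q : DifferenceBundle 𝓔 π) (a : A) : DifferenceBundle 𝓔 π where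
  p₁ := q.p₁
  p₂ := q.p₂
  b := q.b * 𝓔.α a
  same_fibre := q.same_fibre
  lifts := by
    have h : 𝓔.β (𝓔.α a) = 1 := by
      have : 𝓔.α a ∈ 𝓔.β.ker := 𝓔.exact ▸ ⟨a, rfl⟩
      exact this
    rw [map_mul, h, mul_one, q.lifts]

/-- The `G`-action `g (p₁, p₂, b) = (g p₁, g p₂, b)`. -/
def smul (hπ : IsEquivariantBundle EG G EC C EP P EX X π) (g : G) (q : DifferenceBundle 𝓔 π) :
    DifferenceBundle 𝓔 π where
  p₁ := g • q.p₁
  p₂ := g • q.p₂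
  b := q.b
  same_fibre := by rw [hπ.map_smul, hπ.map_smul, q.same_fibre]
  lifts := by rw [← hπ.smul_act, q.lifts]

/-- The multiplication map `m((p₁, p₂, b), (p₂, p₃, b')) = (p₁, p₃, b b')`. -/
def mul (q q' : DifferenceBundle 𝓔 π) (h : q.p₂ = q'.p₁) : DifferenceBundle 𝓔 π where
  p₁ := q.p₁
  p₂ := q'.p₂
  b := q.b * q'.b
  same_fibre := q.same_fibre.trans (h ▸ q'.same_fibre)
  lifts := by rw [map_mul, MulOpposite.op_mul, mul_smul, q.lifts, h, q'.lifts]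

end DifferenceBundle

/-- The pullback connection `ω^{Q_P}` on `Q_P`: the pullback along the projection `Q_P → B` of the
connection on `β : B → C` given by the splitting.  It is the restriction to `Q_P` of the following
`1`-form on `P × P × B`. -/
def differenceForm {𝓔 : LieCentralExtension EA A EB B EC C} (S : 𝓔.AdSplitting) (q : P × P × B) :
    TangentSpace (𝓘(ℝ, EP).prod (𝓘(ℝ, EP).prod 𝓘(ℝ, EB))) q →ₗ[ℝ] GroupLieAlgebra 𝓘(ℝ, EA) A :=
  S.connForm q.2.2 ∘ₗ
    (mfderiv (𝓘(ℝ, EP).prod (𝓘(ℝ, EP).prod 𝓘(ℝ, EB))) 𝓘(ℝ, EB)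
      (fun z : P × P × B => z.2.2) q).toLinearMap

end DifferenceBundle

section BorelSquare

/-- The fibre product `R ×_X R` of a map `ρ : R → X` with itself. -/
def FibreSquare {R X : Type*} (ρ : R → X) : Set (R × R) := {z | ρ z.1 = ρ z.2}

/-- `(r₁, r₂) ∼ (r₁ a, r₂ a)` on `R ×_X R`. -/
def diagonalSetoid (A : Type*) {R X : Type*} [Group A] [MulAction Aᵐᵒᵖ R] (ρ : R → X) :
    Setoid (FibreSquare ρ) where
  r z w := ∃ a : A, w.1.1 = z.1.1 <• a ∧ w.1.2 = z.1.2 <• a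
  iseqv :=
    { refl := fun z => ⟨1, by simp⟩
      symm := by
        rintro z w ⟨a, h₁, h₂⟩
        exact ⟨a⁻¹, by simp [h₁], by simp [h₂]⟩
      trans := by
        rintro z w u ⟨a, h₁, h₂⟩ ⟨a', h₁', h₂'⟩
        exact ⟨a * a', by rw [h₁', h₁, MulOpposite.op_mul, mul_smul],
          by rw [h₂', h₂, MulOpposite.op_mul, mul_smul]⟩ }

/-- The bundle `R ×^A R` over `P ×_X P`, for an `A`-bundle `σ : R → P` and `ρ = π ∘ σ`:
the quotient of `R ×_X R` by the diagonal `A`-action. Since `R ×_X R → R ×^A R` is a surjective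
submersion, a map on `R ×^A R` is smooth if and only if its composition with the quotient map
is smooth. -/
def BorelSquare (A : Type*) {R X : Type*} [Group A] [MulAction Aᵐᵒᵖ R] (ρ : R → X) : Type _ :=
  Quotient (diagonalSetoid A ρ)

/-- The class `[r₁, r₂] ∈ R ×^A R` of `(r₁, r₂) ∈ R ×_X R`. -/
def BorelSquare.mk (A : Type*) {R X : Type*} [Group A] [MulAction Aᵐᵒᵖ R] {ρ : R → X}
    (z : FibreSquare ρ) : BorelSquare A ρ :=
  Quotient.mk (diagonalSetoid A ρ) z

end BorelSquare

/-! ### Equivariant central extensions with admissible connection, and triples -/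

section Main

universe u

variable {EG G EA A EB B EC C EX X EP P : Type*}
  [NormedAddCommGroup EG] [NormedSpace ℝ EG] [TopologicalSpace G] [ChartedSpace EG G] [Group G]
  [NormedAddCommGroup EA] [NormedSpace ℝ EA] [TopologicalSpace A] [ChartedSpace EA A] [CommGroup A]
  [NormedAddCommGroup EB] [NormedSpace ℝ EB] [TopologicalSpace B] [ChartedSpace EB B] [Group B]
  [NormedAddCommGroup EC] [NormedSpace ℝ EC] [TopologicalSpace C] [ChartedSpace EC C] [Group C]
  [NormedAddCommGroup EX] [NormedSpace ℝ EX] [TopologicalSpace X] [ChartedSpace EX X]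
  [NormedAddCommGroup EP] [NormedSpace ℝ EP] [TopologicalSpace P] [ChartedSpace EP P]
  [IsManifold 𝓘(ℝ, EP) ∞ P]
  [MulAction Cᵐᵒᵖ P] [MulAction G X] [MulAction G P]
  (ER : Type*) [NormedAddCommGroup ER] [NormedSpace ℝ ER]

/-- A `G`-equivariant central extension `R → P → X` (by `σ` and `π`, `ρ = π ∘ σ`) of the
`G`-equivariant `C`-bundle `π : P → X` with an admissible `G`-equivariant connection `ω^ρ`, whose
total space `R` is a manifold modelled on `ER`. -/
structure AdmissibleExtension (𝓔 : LieCentralExtension EA A EB B EC C)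
    {π : P → X} (_hπ : IsEquivariantBundle EG G EC C EP P EX X π)
    (ωπ : GConnection G EC C EP P) where
  R : Type u
  [topology : TopologicalSpace R]
  [charts : ChartedSpace ER R]
  [manifold : IsManifold 𝓘(ℝ, ER) ∞ R]
  [actB : MulAction Bᵐᵒᵖ R]
  [actG : MulAction G R]
  /-- the `G`-equivariant principal `B`-bundle -/
  ρ : R → X
  isBundle : IsEquivariantBundle EG G EB B ER R EX X ρ
  /-- the `G`-equivariant `B`-homomorphism to `P` over `X` -/
  σ : R → P
  contMDiff_σ : ContMDiff 𝓘(ℝ, ER) 𝓘(ℝ, EP) ∞ σ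
  σ_act : ∀ (r : R) (b : B), σ (r <• b) = σ r <• 𝓔.β b
  σ_smul : ∀ (g : G) (r : R), σ (g • r) = g • σ r
  π_σ : ∀ r : R, π (σ r) = ρ r
  /-- the connection `ω^ρ` -/
  ωρ : GConnection G EB B ER R
  /-- `β_*(ω^ρ) = σ^* ω^π` -/
  admissible : ∀ (r : R) (v : TangentSpace 𝓘(ℝ, ER) r),
    𝓔.dβ (ωρ.form r v) = ωπ.form (σ r) (mfderiv 𝓘(ℝ, ER) 𝓘(ℝ, EP) σ r v)

attribute [instance] AdmissibleExtension.topology AdmissibleExtension.charts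
  AdmissibleExtension.manifold AdmissibleExtension.actB AdmissibleExtension.actG

/-- A triple `(σ, ω^σ, ψ)`: a `G`-equivariant `A`-bundle `σ : R → P` with `G`-equivariant
connection `ω^σ` and a smooth `G`-equivariant `A`-homomorphism `ψ : R ×^A R → Q_P` over `P ×_X P`
which satisfies the cocycle identity and `pr₂^* ω^σ - pr₁^* ω^σ = ψ^* ω^{Q_P}`.  The total space
`R` is a manifold modelled on `ER`. -/
structure DescentTriple {𝓔 : LieCentralExtension EA A EB B EC C} (S : 𝓔.AdSplitting)
    {π : P → X} (hπ : IsEquivariantBundle EG G EC C EP P EX X π) where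
  R : Type u
  [topology : TopologicalSpace R]
  [charts : ChartedSpace ER R]
  [manifold : IsManifold 𝓘(ℝ, ER) ∞ R]
  [actA : MulAction Aᵐᵒᵖ R]
  [actG : MulAction G R]
  /-- the `G`-equivariant principal `A`-bundle -/
  σ : R → P
  isBundle : IsEquivariantBundle EG G EA A ER R EP P σ
  /-- the connection `ω^σ` -/
  ωσ : GConnection G EA A ER R
  ψ : BorelSquare A (π ∘ σ) → DifferenceBundle 𝓔 π
  /-- smoothness of `ψ`, as a map `R ×_X R → R ×^A R → Q_P ⊆ P × P × B` -/
  smooth_ψ : SmoothOnSubset (𝓘(ℝ, ER).prod 𝓘(ℝ, ER))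
    (𝓘(ℝ, EP).prod (𝓘(ℝ, EP).prod 𝓘(ℝ, EB)))
    (fun z : FibreSquare (π ∘ σ) => (ψ (BorelSquare.mk A z)).coord)
  /-- `ψ` covers the identity of `P ×_X P` -/
  ψ_fst : ∀ z : FibreSquare (π ∘ σ), (ψ (BorelSquare.mk A z)).p₁ = σ z.1.1
  ψ_snd : ∀ z : FibreSquare (π ∘ σ), (ψ (BorelSquare.mk A z)).p₂ = σ z.1.2
  /-- `ψ([r₁, r₂] a) = ψ[r₁, r₂] a`, where `[r₁, r₂] a = [r₁, r₂ a]` -/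
  ψ_act : ∀ (r₁ r₂ : R) (a : A) (h : (r₁, r₂) ∈ FibreSquare (π ∘ σ))
    (h' : (r₁, r₂ <• a) ∈ FibreSquare (π ∘ σ)),
    ψ (BorelSquare.mk A ⟨_, h'⟩) = (ψ (BorelSquare.mk A ⟨_, h⟩)).act a
  /-- `ψ(g [r₁, r₂]) = g ψ[r₁, r₂]`, where `g [r₁, r₂] = [g r₁, g r₂]` -/
  ψ_smul : ∀ (g : G) (r₁ r₂ : R) (h : (r₁, r₂) ∈ FibreSquare (π ∘ σ))
    (h' : (g • r₁, g • r₂) ∈ FibreSquare (π ∘ σ)),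
    ψ (BorelSquare.mk A ⟨_, h'⟩) = (ψ (BorelSquare.mk A ⟨_, h⟩)).smul hπ g
  /-- the cocycle identity `m(ψ[r₁, r₂], ψ[r₂, r₃]) = ψ[r₁, r₃]` -/
  cocycle : ∀ (r₁ r₂ r₃ : R) (h₁₂ : (r₁, r₂) ∈ FibreSquare (π ∘ σ))
    (h₂₃ : (r₂, r₃) ∈ FibreSquare (π ∘ σ)) (h₁₃ : (r₁, r₃) ∈ FibreSquare (π ∘ σ)),
    (ψ (BorelSquare.mk A ⟨_, h₁₂⟩)).mul (ψ (BorelSquare.mk A ⟨_, h₂₃⟩))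
        ((ψ_snd ⟨_, h₁₂⟩).trans (ψ_fst ⟨_, h₂₃⟩).symm)
      = ψ (BorelSquare.mk A ⟨_, h₁₃⟩)
  /-- `pr₂^* ω^σ - pr₁^* ω^σ = ψ^* ω^{Q_P}` on `R ×_X R`: here `v` runs through the vectors tangent
  to `R ×_X R` at `z`, and the differential of `ψ` at `z` is computed by any local smooth
  extension `g`. -/
  connection_eq : ∀ (z : FibreSquare (π ∘ σ)) (g : R × R → P × P × B),
    IsLocalSmoothExtension (𝓘(ℝ, ER).prod 𝓘(ℝ, ER))
      (𝓘(ℝ, EP).prod (𝓘(ℝ, EP).prod 𝓘(ℝ, EB)))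
      (fun z : FibreSquare (π ∘ σ) => (ψ (BorelSquare.mk A z)).coord) z g →
    ∀ v : TangentSpace (𝓘(ℝ, ER).prod 𝓘(ℝ, ER)) z.1,
      mfderiv (𝓘(ℝ, ER).prod 𝓘(ℝ, ER)) 𝓘(ℝ, EX) (fun w : R × R => (π ∘ σ) w.1) z.1 v
        = mfderiv (𝓘(ℝ, ER).prod 𝓘(ℝ, ER)) 𝓘(ℝ, EX) (fun w : R × R => (π ∘ σ) w.2) z.1 v →
      ωσ.form z.1.2 (mfderiv (𝓘(ℝ, ER).prod 𝓘(ℝ, ER)) 𝓘(ℝ, ER) Prod.snd z.1 v)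
          - ωσ.form z.1.1 (mfderiv (𝓘(ℝ, ER).prod 𝓘(ℝ, ER)) 𝓘(ℝ, ER) Prod.fst z.1 v)
        = differenceForm S (g z.1)
            (mfderiv (𝓘(ℝ, ER).prod 𝓘(ℝ, ER))
              (𝓘(ℝ, EP).prod (𝓘(ℝ, EP).prod 𝓘(ℝ, EB))) g z.1 v)

attribute [instance] DescentTriple.topology DescentTriple.charts
  DescentTriple.manifold DescentTriple.actA DescentTriple.actG

/-- The form `η'` on `M'` pulls back to the form `η` on `M` under the diffeomorphism `Φ`. -/
def PullsBackTo {EM M EM' M' V : Type*} [NormedAddCommGroup EM] [NormedSpace ℝ EM]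
    [TopologicalSpace M] [ChartedSpace EM M] [NormedAddCommGroup EM'] [NormedSpace ℝ EM']
    [TopologicalSpace M'] [ChartedSpace EM' M']
    (Φ : M ≃ₘ^∞⟮𝓘(ℝ, EM), 𝓘(ℝ, EM')⟯ M')
    (η' : ∀ x : M', TangentSpace 𝓘(ℝ, EM') x → V) (η : ∀ x : M, TangentSpace 𝓘(ℝ, EM) x → V) :
    Prop :=
  ∀ (x : M) (v : TangentSpace 𝓘(ℝ, EM) x), η' (Φ x) (mfderiv 𝓘(ℝ, EM) 𝓘(ℝ, EM') Φ x v) = η x v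

section PullsBackTo

variable {EM M EM' M' EM'' M'' V : Type*} [NormedAddCommGroup EM] [NormedSpace ℝ EM]
    [TopologicalSpace M] [ChartedSpace EM M] [NormedAddCommGroup EM'] [NormedSpace ℝ EM']
    [TopologicalSpace M'] [ChartedSpace EM' M'] [NormedAddCommGroup EM''] [NormedSpace ℝ EM'']
    [TopologicalSpace M''] [ChartedSpace EM'' M'']
    {η : ∀ x : M, TangentSpace 𝓘(ℝ, EM) x → V} {η' : ∀ x : M', TangentSpace 𝓘(ℝ, EM') x → V}
    {η'' : ∀ x : M'', TangentSpace 𝓘(ℝ, EM'') x → V}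

theorem PullsBackTo.refl : PullsBackTo (Diffeomorph.refl 𝓘(ℝ, EM) M ∞) η η := by
  intro x v
  have : mfderiv 𝓘(ℝ, EM) 𝓘(ℝ, EM) (Diffeomorph.refl 𝓘(ℝ, EM) M ∞) x
      = ContinuousLinearMap.id ℝ _ := mfderiv_id
  rw [this]
  rfl

theorem PullsBackTo.trans {Φ : M ≃ₘ^∞⟮𝓘(ℝ, EM), 𝓘(ℝ, EM')⟯ M'}
    {Ψ : M' ≃ₘ^∞⟮𝓘(ℝ, EM'), 𝓘(ℝ, EM'')⟯ M''} (h : PullsBackTo Φ η' η) (h' : PullsBackTo Ψ η'' η') :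
    PullsBackTo (Φ.trans Ψ) η'' η := by
  intro x v
  have : mfderiv 𝓘(ℝ, EM) 𝓘(ℝ, EM'') (Φ.trans Ψ) x
      = (mfderiv 𝓘(ℝ, EM') 𝓘(ℝ, EM'') Ψ (Φ x)).comp (mfderiv 𝓘(ℝ, EM) 𝓘(ℝ, EM') Φ x) := by
    rw [Diffeomorph.coe_trans]
    exact mfderiv_comp x (Ψ.mdifferentiable (by simp) _) (Φ.mdifferentiable (by simp) _)
  rw [this, ← h x v, ← h' (Φ x)]
  rfl

theorem PullsBackTo.symm {Φ : M ≃ₘ^∞⟮𝓘(ℝ, EM), 𝓘(ℝ, EM')⟯ M'} (h : PullsBackTo Φ η' η) :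
    PullsBackTo Φ.symm η η' := by
  intro y w
  refine (h (Φ.symm y) (mfderiv 𝓘(ℝ, EM') 𝓘(ℝ, EM) Φ.symm y w)).symm.trans ?_
  have h₁ : (mfderiv 𝓘(ℝ, EM) 𝓘(ℝ, EM') Φ (Φ.symm y)).comp
      (mfderiv 𝓘(ℝ, EM') 𝓘(ℝ, EM) Φ.symm y) = ContinuousLinearMap.id ℝ _ := by
    rw [← mfderiv_comp y (Φ.mdifferentiable (by simp) _) (Φ.symm.mdifferentiable (by simp) _)]
    have : (Φ ∘ Φ.symm) = id := by ext z; simp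
    rw [this]
    exact mfderiv_id
  have h₂ : mfderiv 𝓘(ℝ, EM) 𝓘(ℝ, EM') Φ (Φ.symm y) (mfderiv 𝓘(ℝ, EM') 𝓘(ℝ, EM) Φ.symm y w)
      = (show EM' from w) := congrArg (fun L : EM' →L[ℝ] EM' => L w) h₁
  rw [h₂]
  have aux : ∀ y', y' = y → η' y' (show EM' from w) = η' y w := by
    rintro _ rfl
    rfl
  exact aux _ (Φ.apply_symm_apply y)

end PullsBackTo

namespace AdmissibleExtension

variable {ER} {𝓔 : LieCentralExtension EA A EB B EC C}
  {π : P → X} {hπ : IsEquivariantBundle EG G EC C EP P EX X π} {ωπ : GConnection G EC C EP P}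

/-- An isomorphism of central extensions of `P` with connection: a `B`- and `G`-equivariant
diffeomorphism of the total spaces over `P` which preserves the connections. -/
def Isomorphic (E E' : AdmissibleExtension.{u} ER 𝓔 hπ ωπ) : Prop :=
  ∃ Φ : E.R ≃ₘ^∞⟮𝓘(ℝ, ER), 𝓘(ℝ, ER)⟯ E'.R,
    (∀ (r : E.R) (b : B), Φ (r <• b) = Φ r <• b) ∧
    (∀ (g : G) (r : E.R), Φ (g • r) = g • Φ r) ∧
    (∀ r : E.R, E'.σ (Φ r) = E.σ r) ∧
    PullsBackTo Φ (fun r v => E'.ωρ.form r v) (fun r v => E.ωρ.form r v)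

/-- Isomorphism is an equivalence relation. -/
instance setoid : Setoid (AdmissibleExtension.{u} ER 𝓔 hπ ωπ) where
  r := Isomorphic
  iseqv :=
    { refl := fun E => ⟨Diffeomorph.refl _ _ _, fun _ _ => rfl, fun _ _ => rfl, fun _ => rfl,
        PullsBackTo.refl⟩
      symm := by
        rintro E E' ⟨Φ, hB, hG, hσ, hω⟩
        refine ⟨Φ.symm, fun r b => ?_, fun g r => ?_, fun r => ?_, hω.symm⟩
        · apply Φ.injective; simp [hB]
        · apply Φ.injective; simp [hG]
        · simp [← hσ]
      trans := by
        rintro E E' E'' ⟨Φ, hB, hG, hσ, hω⟩ ⟨Φ', hB', hG', hσ', hω'⟩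
        exact ⟨Φ.trans Φ', by simp [hB, hB'], by simp [hG, hG'], by simp [hσ, hσ'], hω.trans hω'⟩ }

end AdmissibleExtension

namespace DescentTriple

variable {ER} {𝓔 : LieCentralExtension EA A EB B EC C} {S : 𝓔.AdSplitting}
  {π : P → X} {hπ : IsEquivariantBundle EG G EC C EP P EX X π}

/-- An isomorphism of triples: a `G`-equivariant isomorphism of `A`-bundles over `P` which preserves
the connections and satisfies `ψ'[Φ r₁, Φ r₂] = ψ[r₁, r₂]`. -/
def Isomorphic (T T' : DescentTriple.{u} ER S hπ) : Prop :=
  ∃ Φ : T.R ≃ₘ^∞⟮𝓘(ℝ, ER), 𝓘(ℝ, ER)⟯ T'.R,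
    (∀ (r : T.R) (a : A), Φ (r <• a) = Φ r <• a) ∧
    (∀ (g : G) (r : T.R), Φ (g • r) = g • Φ r) ∧
    (∀ r : T.R, T'.σ (Φ r) = T.σ r) ∧
    PullsBackTo Φ (fun r v => T'.ωσ.form r v) (fun r v => T.ωσ.form r v) ∧
    ∀ (r₁ r₂ : T.R) (h : (r₁, r₂) ∈ FibreSquare (π ∘ T.σ))
      (h' : (Φ r₁, Φ r₂) ∈ FibreSquare (π ∘ T'.σ)),
      T'.ψ (BorelSquare.mk A ⟨_, h'⟩) = T.ψ (BorelSquare.mk A ⟨_, h⟩)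

/-- Isomorphism is an equivalence relation. -/
instance setoid : Setoid (DescentTriple.{u} ER S hπ) where
  r := Isomorphic
  iseqv :=
    { refl := fun T => ⟨Diffeomorph.refl _ _ _, fun _ _ => rfl, fun _ _ => rfl, fun _ => rfl,
        PullsBackTo.refl, fun _ _ _ _ => rfl⟩
      symm := by
        rintro T T' ⟨Φ, hA, hG, hσ, hω, hψ⟩
        refine ⟨Φ.symm, fun r a => ?_, fun g r => ?_, fun r => ?_, hω.symm, fun r₁ r₂ h h' => ?_⟩
        · apply Φ.injective; simp [hA]
        · apply Φ.injective; simp [hG]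
        · simp [← hσ]
        · rw [← hψ _ _ h' (by simpa using h)]
          simp
      trans := by
        rintro T T' T'' ⟨Φ, hA, hG, hσ, hω, hψ⟩ ⟨Φ', hA', hG', hσ', hω', hψ'⟩
        refine ⟨Φ.trans Φ', by simp [hA, hA'], by simp [hG, hG'], by simp [hσ, hσ'],
          hω.trans hω', fun r₁ r₂ h h' => ?_⟩
        have h'' : (Φ r₁, Φ r₂) ∈ FibreSquare (π ∘ T'.σ) := by
          simpa [FibreSquare, hσ] using h
        rw [← hψ r₁ r₂ h h'', ← hψ' _ _ h'' h']
        rfl }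

end DescentTriple

/-- The triple `(σ, ω^σ, ψ)` belongs to the central extension `E` with connection `ω^ρ`:
up to an identification `Φ` of the total spaces over `P` (as `G`-equivariant `A`-bundles, where `A`
acts on `E.R` through `α`), `ω^σ` is the `𝔞`-component `t(ω^ρ)` of `ω^ρ`, and `ψ` is the difference
map of the `B`-bundle `ρ`, i.e. `r₁ ψ[r₁, r₂] = r₂`. -/
def Corresponds {ER : Type*} [NormedAddCommGroup ER] [NormedSpace ℝ ER]
    {𝓔 : LieCentralExtension EA A EB B EC C} {S : 𝓔.AdSplitting}
    {π : P → X} {hπ : IsEquivariantBundle EG G EC C EP P EX X π} {ωπ : GConnection G EC C EP P}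
    (E : AdmissibleExtension.{u} ER 𝓔 hπ ωπ) (T : DescentTriple.{u} ER S hπ) : Prop :=
  ∃ Φ : E.R ≃ₘ^∞⟮𝓘(ℝ, ER), 𝓘(ℝ, ER)⟯ T.R,
    (∀ (r : E.R) (a : A), Φ (r <• 𝓔.α a) = Φ r <• a) ∧
    (∀ (g : G) (r : E.R), Φ (g • r) = g • Φ r) ∧
    (∀ r : E.R, T.σ (Φ r) = E.σ r) ∧
    PullsBackTo Φ (fun r v => T.ωσ.form r v) (fun r v => S.t (E.ωρ.form r v)) ∧
    ∀ (r₁ r₂ : E.R) (h : (Φ r₁, Φ r₂) ∈ FibreSquare (π ∘ T.σ)),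
      r₁ <• (T.ψ (BorelSquare.mk A ⟨_, h⟩)).b = r₂

end Main

end

/-!
The relation `Corresponds E T` between central extensions with connection and triples is shown to be
total and unique up to isomorphism on both sides; it then induces the bijection of isomorphism
classes.

From `E` to `T` (`AdmissibleExtension.toTriple`): `A` acts on `R` through `α`, and `R → P` is a
principal `A`-bundle because `R → X` and `β` have smooth local sections
(`IsPrincipalBundle.restrict`). The form `t ∘ ω^ρ` is a connection, and `ψ[r₁, r₂]` is given by the
element `b` with `r₁ b = r₂`. Differentiating this equation along `R ×_X R` yields
`ω^ρ(v₂) = Ad(b⁻¹) ω^ρ(v₁) + θ_B(db)` (`GConnection.onModel_snd`). Here the vectors tangent to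
`R ×_X R` are handled through a local retraction of `R × R` onto it
(`IsPrincipalBundle.exists_retraction`). Since `t` is `Ad`-invariant
(`LieCentralExtension.AdSplitting.modelT_modelAd`), applying `t` gives the equation relating `ω^σ`
to `ω^{Q_P}`.

From `T` to `E` (`DescentTriple.toExtension`): `r b` is the unique point of `R` with
`ψ[r, r b] = (σ r, σ(r) β(b), b)`. The cocycle identity makes this an action, and local sections of
`R → P` together with the smoothness of `ψ` and of `α⁻¹ : α(A) → A` show that it is smooth
(`DescentTriple.contMDiff_translate`) and that `R → X` is a principal `B`-bundle
(`DescentTriple.isPrincipalBundle_proj`). The connection is `α_* ω^σ + s(σ^* ω^π)`; its values on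
vertical vectors and its equivariance follow from the equation for `ω^σ`, pulled back along
`b ↦ (r, r b)` and `r ↦ (r, r b)` (`DescentTriple.connection_along`).

Uniqueness (`Corresponds.equiv_left`, `Corresponds.equiv_right`): the `B`-action and `ψ` determine
each other, and `ω^ρ = α_* t(ω^ρ) + s β_*(ω^ρ)` with `t(ω^ρ) = ω^σ` and `β_*(ω^ρ) = σ^* ω^π`.
-/

/-! ### The differential as a map of model spaces -/

section ModelDeriv

variable {E H M E' H' M' E'' H'' M'' F : Type*}
  [NormedAddCommGroup E] [NormedSpace ℝ E] [TopologicalSpace H]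
  [TopologicalSpace M] [ChartedSpace H M]
  [NormedAddCommGroup E'] [NormedSpace ℝ E'] [TopologicalSpace H']
  [TopologicalSpace M'] [ChartedSpace H' M']
  [NormedAddCommGroup E''] [NormedSpace ℝ E''] [TopologicalSpace H'']
  [TopologicalSpace M''] [ChartedSpace H'' M'']
  {I : ModelWithCorners ℝ E H} {J : ModelWithCorners ℝ E' H'} {L : ModelWithCorners ℝ E'' H''}

variable (I J) in
/-- The differential `mfderiv I J f x`, with its tangent spaces identified with the model spaces.
Since its type does not depend on `x` and `f x`, the base points can be rewritten freely. -/
noncomputable def modelDeriv (f : M → M') (x : M) : E →L[ℝ] E' := mfderiv I J f x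

theorem ContMDiffAt.mdiff {f : M → M'} {x : M} (hf : ContMDiffAt I J ∞ f x) :
    MDifferentiableAt I J f x :=
  hf.mdifferentiableAt (by simp)

theorem modelDeriv_comp {g : M' → M''} {f : M → M'} {x : M}
    (hg : ContMDiffAt J L ∞ g (f x)) (hf : ContMDiffAt I J ∞ f x) (v : E) :
    modelDeriv I L (fun z => g (f z)) x v = modelDeriv J L g (f x) (modelDeriv I J f x v) :=
  mfderiv_comp_apply x hg.mdiff hf.mdiff v

theorem modelDeriv_congr {f g : M → M'} {x : M} (h : f =ᶠ[nhds x] g) :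
    modelDeriv I J f x = modelDeriv I J g x :=
  h.mfderiv_eq

theorem modelDeriv_id (x : M) (v : E) : modelDeriv I I (fun z : M => z) x v = v :=
  congrArg (fun T : E →L[ℝ] E => T v) (mfderiv_id (I := I) (x := x))

theorem modelDeriv_const (y : M') (x : M) (v : E) : modelDeriv I J (fun _ : M => y) x v = 0 :=
  congrArg (fun T : E →L[ℝ] E' => T v) (mfderiv_const (I := I) (I' := J) (x := x) (c := y))

theorem modelDeriv_fst (z : M × M') (v : E × E') :
    modelDeriv (I.prod J) I (fun w : M × M' => w.1) z v = v.1 :=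
  congrArg (fun T : E × E' →L[ℝ] E => T v) (mfderiv_fst (I := I) (I' := J) (x := z))

theorem modelDeriv_snd (z : M × M') (v : E × E') :
    modelDeriv (I.prod J) J (fun w : M × M' => w.2) z v = v.2 :=
  congrArg (fun T : E × E' →L[ℝ] E' => T v) (mfderiv_snd (I := I) (I' := J) (x := z))

theorem modelDeriv_prodMk {f : M → M'} {g : M → M''} {x : M}
    (hf : ContMDiffAt I J ∞ f x) (hg : ContMDiffAt I L ∞ g x) (v : E) :
    modelDeriv I (J.prod L) (fun z => (f z, g z)) x v
      = (modelDeriv I J f x v, modelDeriv I L g x v) :=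
  congrArg (fun T : E →L[ℝ] E' × E'' => T v)
    (hf.mdiff.hasMFDerivAt.prodMk hg.mdiff.hasMFDerivAt).mfderiv

/-- The differential of a function of two variables is the sum of its partial differentials. -/
theorem modelDeriv_prod {f : M × M' → M''} {p : M × M'} (hf : ContMDiffAt (I.prod J) L ∞ f p)
    (v : E × E') :
    modelDeriv (I.prod J) L f p v
      = modelDeriv I L (fun x => f (x, p.2)) p.1 v.1
        + modelDeriv J L (fun y => f (p.1, y)) p.2 v.2 :=
  mfderiv_prod_eq_add_apply hf.mdiff

end ModelDeriv

theorem act_act {K M : Type*} [Monoid K] [MulAction Kᵐᵒᵖ M] (p : M) (k k' : K) :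
    (p <• k) <• k' = p <• (k * k') := by
  rw [MulOpposite.op_mul, mul_smul]

theorem act_one {K M : Type*} [Monoid K] [MulAction Kᵐᵒᵖ M] (p : M) : p <• (1 : K) = p := by
  simp

/-! ### Principal bundles in terms of local sections -/

section Gauges

variable {EK K EM M EX X : Type*}
  [NormedAddCommGroup EK] [NormedSpace ℝ EK] [TopologicalSpace K] [ChartedSpace EK K] [Group K]
  [NormedAddCommGroup EM] [NormedSpace ℝ EM] [TopologicalSpace M] [ChartedSpace EM M]
  [NormedAddCommGroup EX] [NormedSpace ℝ EX] [TopologicalSpace X] [ChartedSpace EX X]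
  [MulAction Kᵐᵒᵖ M]

variable (EK EM EX) in
/-- A gauge of `π : M → X` over an open set `U`: a smooth local section `τ` over `U` together with
the smooth map `κ : π⁻¹(U) → K` determined by `p = τ(π p) κ(p)`.  Outside `U` and `π⁻¹(U)` the
values of `τ` and `κ` are irrelevant. -/
structure IsGauge (π : M → X) (U : Set X) (κ : M → K) (τ : X → M) : Prop where
  isOpen : IsOpen U
  smooth_coord : ∀ p, π p ∈ U → ContMDiffAt 𝓘(ℝ, EM) 𝓘(ℝ, EK) ∞ κ p
  smooth_section : ∀ x ∈ U, ContMDiffAt 𝓘(ℝ, EX) 𝓘(ℝ, EM) ∞ τ x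
  proj_section : ∀ x ∈ U, π (τ x) = x
  coord_section : ∀ x ∈ U, κ (τ x) = 1
  coord_act : ∀ p, π p ∈ U → ∀ k, κ (p <• k) = κ p * k
  section_act_coord : ∀ p, π p ∈ U → τ (π p) <• κ p = p

namespace IsPrincipalBundle

variable {π : M → X}

theorem exists_gauge (h : IsPrincipalBundle EK K EM M EX X π) (x : X) :
    ∃ (U : Set X) (κ : M → K) (τ : X → M), x ∈ U ∧ IsGauge EK EM EX π U κ τ := by
  obtain ⟨U, hU, hx, e, hs, ht, he, he', heq⟩ := h.locally_trivial x
  have hmt : ∀ y ∈ U, ∀ k : K, (y, k) ∈ e.target := fun y hy k => by rw [ht]; exact ⟨hy, trivial⟩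
  have hms : ∀ p, π p ∈ U → p ∈ e.source := fun p hp => by rw [hs]; exact hp
  have hπs : ∀ y ∈ U, π (e.symm (y, 1)) = y := fun y hy => by
    rw [← (heq _ (e.map_target (hmt y hy 1))).1, e.right_inv (hmt y hy 1)]
  refine ⟨U, fun p => (e p).2, fun y => e.symm (y, 1), hx, hU, fun p hp => ?_, fun y hy => ?_,
    hπs, fun y hy => ?_, fun p hp k => ?_, fun p hp => ?_⟩
  · exact contMDiffAt_snd.comp p (he.contMDiffAt (e.open_source.mem_nhds (hms p hp)))
  · exact ContMDiffAt.comp (g := e.symm) (f := fun y : X => (y, (1 : K))) y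
      (he'.contMDiffAt (e.open_target.mem_nhds (hmt y hy 1)))
      (contMDiffAt_id.prodMk contMDiffAt_const)
  · simp only [e.right_inv (hmt y hy 1)]
  · simp only [(heq p (hms p hp)).2 k]
  · have h1 : e.symm (π p, 1) ∈ e.source := e.map_target (hmt _ hp 1)
    apply e.injOn
    · rw [hs, Set.mem_preimage, h.map_act, hπs _ hp]; exact hp
    · exact hms p hp
    · rw [(heq _ h1).2, hπs _ hp, e.right_inv (hmt _ hp 1), one_mul, ← (heq p (hms p hp)).1]

theorem contMDiff_proj (h : IsPrincipalBundle EK K EM M EX X π) :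
    ContMDiff 𝓘(ℝ, EM) 𝓘(ℝ, EX) ∞ π := by
  intro p
  obtain ⟨U, hU, hx, e, hs, ht, he, he', heq⟩ := h.locally_trivial (π p)
  have hp : p ∈ e.source := by rw [hs]; exact hx
  refine (contMDiffAt_fst.comp p (he.contMDiffAt (e.open_source.mem_nhds hp))).congr_of_eventuallyEq ?_
  filter_upwards [e.open_source.mem_nhds hp] with q hq using (heq q hq).1.symm

/-- A smooth action with smooth invariant projection that admits gauges near every point of the base
is a principal bundle. -/
theorem of_gauges
    (hact : ContMDiff (𝓘(ℝ, EM).prod 𝓘(ℝ, EK)) 𝓘(ℝ, EM) ∞ (fun z : M × K => z.1 <• z.2))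
    (hinv : ∀ (p : M) (k : K), π (p <• k) = π p)
    (hπ : ContMDiff 𝓘(ℝ, EM) 𝓘(ℝ, EX) ∞ π)
    (hg : ∀ x, ∃ (U : Set X) (κ : M → K) (τ : X → M), x ∈ U ∧ IsGauge EK EM EX π U κ τ) :
    IsPrincipalBundle EK K EM M EX X π where
  contMDiff_act := hact
  map_act := hinv
  locally_trivial x := by
    obtain ⟨U, κ, τ, hx, g⟩ := hg x
    have hf : ContMDiffOn 𝓘(ℝ, EM) (𝓘(ℝ, EX).prod 𝓘(ℝ, EK)) ∞ (fun p => (π p, κ p)) (π ⁻¹' U) :=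
      fun p hp => ((hπ p).prodMk (g.smooth_coord p hp)).contMDiffWithinAt
    have hb : ContMDiffOn (𝓘(ℝ, EX).prod 𝓘(ℝ, EK)) 𝓘(ℝ, EM) ∞ (fun z : X × K => τ z.1 <• z.2)
        (U ×ˢ Set.univ) := fun z hz =>
      (ContMDiffAt.comp (g := fun w : M × K => w.1 <• w.2)
        (f := fun z : X × K => (τ z.1, z.2)) z (hact _)
        ((ContMDiffAt.comp (g := τ) (f := Prod.fst) z
          (g.smooth_section z.1 hz.1) contMDiffAt_fst).prodMk contMDiffAt_snd)).contMDiffWithinAt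
    refine ⟨U, g.isOpen, hx,
      { toFun := fun p => (π p, κ p)
        invFun := fun z => τ z.1 <• z.2
        source := π ⁻¹' U
        target := U ×ˢ Set.univ
        map_source' := fun p hp => ⟨hp, trivial⟩
        map_target' := fun z hz => ?_
        left_inv' := fun p hp => g.section_act_coord p hp
        right_inv' := fun z hz => ?_
        open_source := g.isOpen.preimage hπ.continuous
        open_target := g.isOpen.prod isOpen_univ
        continuousOn_toFun := hf.continuousOn
        continuousOn_invFun := hb.continuousOn }, rfl, rfl, hf, hb, fun p hp => ⟨rfl, fun k => ?_⟩⟩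
    · rw [Set.mem_preimage, hinv, g.proj_section _ hz.1]; exact hz.1
    · have h1 := g.proj_section _ hz.1
      refine Prod.ext ?_ ?_
      · simp only [hinv, h1]
      · simp only
        rw [g.coord_act _ (by rw [h1]; exact hz.1), g.coord_section _ hz.1, one_mul]
    · exact Prod.ext (hinv p k) (g.coord_act p hp k)

theorem act_injective (h : IsPrincipalBundle EK K EM M EX X π) (p : M) {k k' : K}
    (hk : p <• k = p <• k') : k = k' := by
  obtain ⟨U, κ, τ, hx, g⟩ := h.exists_gauge (π p)
  have := congrArg κ hk
  rw [g.coord_act p hx, g.coord_act p hx] at this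
  exact mul_left_cancel this

end IsPrincipalBundle

theorem IsGauge.act_div {π : M → X} {U : Set X} {κ : M → K} {τ : X → M}
    (g : IsGauge EK EM EX π U κ τ) {p q : M} (hp : π p ∈ U) (hpq : π p = π q) :
    p <• ((κ p)⁻¹ * κ q) = q := by
  have h1 := g.section_act_coord p hp
  have h2 := g.section_act_coord q (hpq ▸ hp)
  calc p <• ((κ p)⁻¹ * κ q) = (τ (π p) <• κ p) <• ((κ p)⁻¹ * κ q) := by rw [h1]
    _ = q := by rw [act_act, mul_inv_cancel_left, hpq, h2]

theorem IsPrincipalBundle.exists_act_eq {π : M → X} (h : IsPrincipalBundle EK K EM M EX X π)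
    {p q : M} (hpq : π p = π q) : ∃ k : K, p <• k = q := by
  obtain ⟨U, κ, τ, hx, g⟩ := h.exists_gauge (π p)
  exact ⟨_, g.act_div hx hpq⟩

/-- The difference of two points in the same fibre: `p (div p q) = q`. -/
noncomputable def IsPrincipalBundle.div {π : M → X} (h : IsPrincipalBundle EK K EM M EX X π)
    {p q : M} (hpq : π p = π q) : K :=
  (h.exists_act_eq hpq).choose

theorem IsPrincipalBundle.act_div {π : M → X} (h : IsPrincipalBundle EK K EM M EX X π)
    {p q : M} (hpq : π p = π q) : p <• h.div hpq = q :=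
  (h.exists_act_eq hpq).choose_spec

theorem IsPrincipalBundle.div_eq {π : M → X} (h : IsPrincipalBundle EK K EM M EX X π)
    {p q : M} (hpq : π p = π q) {k : K} (hk : p <• k = q) : h.div hpq = k :=
  h.act_injective p ((h.act_div hpq).trans hk.symm)

theorem IsPrincipalBundle.contMDiff_act_right {π : M → X} (h : IsPrincipalBundle EK K EM M EX X π)
    (k : K) : ContMDiff 𝓘(ℝ, EM) 𝓘(ℝ, EM) ∞ (fun p : M => p <• k) :=
  h.contMDiff_act.comp (g := fun z : M × K => z.1 <• z.2) (f := fun p : M => (p, k))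
    (contMDiff_id.prodMk contMDiff_const)

theorem IsPrincipalBundle.contMDiff_orbit {π : M → X} (h : IsPrincipalBundle EK K EM M EX X π)
    (p : M) : ContMDiff 𝓘(ℝ, EK) 𝓘(ℝ, EM) ∞ (fun k : K => p <• k) :=
  h.contMDiff_act.comp (g := fun z : M × K => z.1 <• z.2) (f := fun k : K => (p, k))
    (contMDiff_const.prodMk contMDiff_id)

/-- A vector `v` tangent to `M ×_X M` at `z` is the image of itself under the differential of a local
smooth retraction onto `M ×_X M`, namely `(p, q) ↦ (p, τ(π p) κ(q))` for a gauge `(τ, κ)`. -/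
theorem IsPrincipalBundle.exists_retraction {π : M → X} (h : IsPrincipalBundle EK K EM M EX X π)
    {z : M × M} (hz : z ∈ FibreSquare π) {v : EM × EM}
    (hv : modelDeriv 𝓘(ℝ, EM) 𝓘(ℝ, EX) π z.1 v.1 = modelDeriv 𝓘(ℝ, EM) 𝓘(ℝ, EX) π z.2 v.2) :
    ∃ F : M × M → M × M,
      ContMDiffAt (𝓘(ℝ, EM).prod 𝓘(ℝ, EM)) (𝓘(ℝ, EM).prod 𝓘(ℝ, EM)) ∞ F z ∧
      F z = z ∧ (∀ᶠ w in nhds z, F w ∈ FibreSquare π) ∧ (∀ w, (F w).1 = w.1) ∧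
      modelDeriv (𝓘(ℝ, EM).prod 𝓘(ℝ, EM)) (𝓘(ℝ, EM).prod 𝓘(ℝ, EM)) F z v = v := by
  obtain ⟨U, κ, τ, hx, g⟩ := h.exists_gauge (π z.1)
  have hz' : π z.1 = π z.2 := hz
  have hx2 : π z.2 ∈ U := hz' ▸ hx
  -- the two-variable map `(x, k) ↦ τ(x) k`
  set Θ : X × K → M := fun y => τ y.1 <• y.2 with hΘ
  have sΘ : ∀ y : X × K, y.1 ∈ U → ContMDiffAt (𝓘(ℝ, EX).prod 𝓘(ℝ, EK)) 𝓘(ℝ, EM) ∞ Θ y :=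
    fun y hy => ContMDiffAt.comp (g := fun w : M × K => w.1 <• w.2)
      (f := fun y : X × K => (τ y.1, y.2)) y (h.contMDiff_act _)
      ((ContMDiffAt.comp (g := τ) (f := Prod.fst) y
        (g.smooth_section y.1 hy) contMDiffAt_fst).prodMk contMDiffAt_snd)
  have s1 : ContMDiffAt (𝓘(ℝ, EM).prod 𝓘(ℝ, EM)) 𝓘(ℝ, EX) ∞ (fun w : M × M => π w.1) z :=
    (h.contMDiff_proj _).comp (f := Prod.fst) z contMDiffAt_fst
  have s2 : ContMDiffAt (𝓘(ℝ, EM).prod 𝓘(ℝ, EM)) 𝓘(ℝ, EK) ∞ (fun w : M × M => κ w.2) z :=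
    (g.smooth_coord _ hx2).comp (f := Prod.snd) z contMDiffAt_snd
  have s3 : ContMDiffAt (𝓘(ℝ, EM).prod 𝓘(ℝ, EM)) 𝓘(ℝ, EM) ∞
      (fun w : M × M => Θ (π w.1, κ w.2)) z :=
    ContMDiffAt.comp (g := Θ) (f := fun w : M × M => (π w.1, κ w.2)) z (sΘ _ hx) (s1.prodMk s2)
  refine ⟨fun w => (w.1, Θ (π w.1, κ w.2)), contMDiffAt_fst.prodMk s3, ?_, ?_, fun _ => rfl, ?_⟩
  · refine Prod.ext rfl ?_
    simp only [hΘ, hz']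
    exact g.section_act_coord _ hx2
  · filter_upwards [s1.continuousAt.preimage_mem_nhds (g.isOpen.mem_nhds hx)] with w hw
    change π w.1 = π (τ (π w.1) <• κ w.2)
    rw [h.map_act, g.proj_section _ hw]
  · rw [modelDeriv_prodMk contMDiffAt_fst s3, modelDeriv_fst]
    refine Prod.ext rfl ?_
    have e1 : modelDeriv (𝓘(ℝ, EM).prod 𝓘(ℝ, EM)) 𝓘(ℝ, EM)
        (fun w : M × M => Θ (π w.1, κ w.2)) z v
        = modelDeriv (𝓘(ℝ, EX).prod 𝓘(ℝ, EK)) 𝓘(ℝ, EM) Θ (π z.1, κ z.2)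
          (modelDeriv 𝓘(ℝ, EM) 𝓘(ℝ, EX) π z.1 v.1, modelDeriv 𝓘(ℝ, EM) 𝓘(ℝ, EK) κ z.2 v.2) := by
      rw [modelDeriv_comp (g := Θ) (f := fun w : M × M => (π w.1, κ w.2)) (sΘ _ hx) (s1.prodMk s2),
        modelDeriv_prodMk s1 s2,
        modelDeriv_comp (g := π) (f := Prod.fst) (h.contMDiff_proj _) contMDiffAt_fst,
        modelDeriv_comp (g := κ) (f := Prod.snd) (g.smooth_coord _ hx2) contMDiffAt_snd]
      erw [modelDeriv_fst, modelDeriv_snd]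
    have e2 : modelDeriv 𝓘(ℝ, EM) 𝓘(ℝ, EM) (fun q : M => Θ (π q, κ q)) z.2 v.2
        = modelDeriv (𝓘(ℝ, EX).prod 𝓘(ℝ, EK)) 𝓘(ℝ, EM) Θ (π z.2, κ z.2)
          (modelDeriv 𝓘(ℝ, EM) 𝓘(ℝ, EX) π z.2 v.2, modelDeriv 𝓘(ℝ, EM) 𝓘(ℝ, EK) κ z.2 v.2) := by
      rw [modelDeriv_comp (g := Θ) (f := fun q : M => (π q, κ q)) (sΘ _ hx2)
        ((h.contMDiff_proj _).prodMk (g.smooth_coord _ hx2)),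
        modelDeriv_prodMk (h.contMDiff_proj _) (g.smooth_coord _ hx2)]
    have e3 : (fun q : M => Θ (π q, κ q)) =ᶠ[nhds z.2] fun q => q := by
      filter_upwards [(h.contMDiff_proj _).continuousAt.preimage_mem_nhds (g.isOpen.mem_nhds hx2)]
        with q hq using g.section_act_coord q hq
    rw [modelDeriv_congr e3, modelDeriv_id] at e2
    exact e1.trans (by rw [hv, hz', ← e2])

end Gauges

/-! ### Connection forms on model spaces -/

section Connections

variable {G EK K EM M EX X : Type*}
  [NormedAddCommGroup EK] [NormedSpace ℝ EK] [TopologicalSpace K] [ChartedSpace EK K] [Group K]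
  [NormedAddCommGroup EM] [NormedSpace ℝ EM] [TopologicalSpace M] [ChartedSpace EM M]
  [NormedAddCommGroup EX] [NormedSpace ℝ EX] [TopologicalSpace X] [ChartedSpace EX X]
  [Group G] [MulAction Kᵐᵒᵖ M] [MulAction G M]

theorem IsEquivariantBundle.contMDiff_smul_left {EG : Type*} [NormedAddCommGroup EG]
    [NormedSpace ℝ EG] [TopologicalSpace G] [ChartedSpace EG G] [MulAction G X] {π : M → X}
    (h : IsEquivariantBundle EG G EK K EM M EX X π) (g : G) :
    ContMDiff 𝓘(ℝ, EM) 𝓘(ℝ, EM) ∞ (fun p : M => g • p) :=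
  h.contMDiff_smul.contMDiff_smul.comp (g := fun z : G × M => z.1 • z.2) (f := fun p : M => (g, p))
    (contMDiff_const.prodMk contMDiff_id)

variable [IsManifold 𝓘(ℝ, EM) ∞ M]

variable (EK) in
/-- The adjoint action `lieAd` on the model space of the Lie group. -/
noncomputable def modelAd (k : K) : EK →L[ℝ] EK :=
  modelDeriv 𝓘(ℝ, EK) 𝓘(ℝ, EK) (fun x : K => k * x * k⁻¹) 1

variable (EK) in
/-- The Maurer-Cartan form on the model space of the Lie group. -/
noncomputable def modelMaurerCartan (k : K) : EK →L[ℝ] EK :=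
  modelDeriv 𝓘(ℝ, EK) 𝓘(ℝ, EK) (fun x : K => k⁻¹ * x) k

theorem modelAd_of_central {k : K} (hk : ∀ x, k * x = x * k) (ξ : EK) : modelAd EK k ξ = ξ := by
  have : (fun x : K => k * x * k⁻¹) = fun x => x := by
    ext x; rw [hk, mul_inv_cancel_right]
  rw [modelAd, this, modelDeriv_id]

theorem contMDiff_conj [LieGroup 𝓘(ℝ, EK) ∞ K] (k : K) :
    ContMDiff 𝓘(ℝ, EK) 𝓘(ℝ, EK) ∞ (fun x : K => k * x * k⁻¹) :=
  (contMDiff_const.mul contMDiff_id).mul contMDiff_const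

namespace GConnection

/-- The connection form, with tangent spaces identified with the model spaces. -/
def onModel (ϖ : GConnection G EK K EM M) (p : M) : EM →L[ℝ] EK := ϖ.form p

theorem smooth_onModel (ϖ : GConnection G EK K EM M) :
    ContMDiff 𝓘(ℝ, EM).tangent 𝓘(ℝ, EK) ∞
      (fun v : TangentBundle 𝓘(ℝ, EM) M => ϖ.onModel v.1 v.2) :=
  ϖ.smooth

theorem onModel_vertical (ϖ : GConnection G EK K EM M) (p : M) (ξ : EK) :
    ϖ.onModel p (modelDeriv 𝓘(ℝ, EK) 𝓘(ℝ, EM) (fun k : K => p <• k) 1 ξ) = ξ := by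
  have h : ϖ.onModel (p <• (1 : K))
      (modelDeriv 𝓘(ℝ, EK) 𝓘(ℝ, EM) (fun k : K => p <• k) 1 ξ) = ξ := ϖ.vertical p ξ
  rwa [act_one] at h

theorem onModel_act (ϖ : GConnection G EK K EM M) (p : M) (k : K) (v : EM) :
    ϖ.onModel (p <• k) (modelDeriv 𝓘(ℝ, EM) 𝓘(ℝ, EM) (fun q : M => q <• k) p v)
      = modelAd EK k⁻¹ (ϖ.onModel p v) :=
  ϖ.equivariant p k v

theorem onModel_smul (ϖ : GConnection G EK K EM M) (g : G) (p : M) (v : EM) :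
    ϖ.onModel (g • p) (modelDeriv 𝓘(ℝ, EM) 𝓘(ℝ, EM) (fun q : M => g • q) p v) = ϖ.onModel p v :=
  ϖ.invariant g p v

/-- On the orbit through `p` a connection form restricts to the Maurer-Cartan form. -/
theorem onModel_orbit [LieGroup 𝓘(ℝ, EK) ∞ K] {π : M → X}
    (h : IsPrincipalBundle EK K EM M EX X π) (ϖ : GConnection G EK K EM M) (p : M) (k : K) (w : EK) :
    ϖ.onModel (p <• k) (modelDeriv 𝓘(ℝ, EK) 𝓘(ℝ, EM) (fun k : K => p <• k) k w)
      = modelMaurerCartan EK k w := by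
  have e : (fun x : K => p <• x) = fun x : K => (p <• k) <• (k⁻¹ * x) := by
    ext x; rw [act_act, mul_inv_cancel_left]
  rw [e, modelDeriv_comp (g := fun y : K => (p <• k) <• y) (f := fun x : K => k⁻¹ * x)
    (h.contMDiff_orbit _ _) (contMDiff_mul_left _), inv_mul_cancel, onModel_vertical]
  rfl

/-- A connection from a connection form expressed on model spaces. -/
def ofModel (form : M → EM →L[ℝ] EK)
    (smooth : ContMDiff 𝓘(ℝ, EM).tangent 𝓘(ℝ, EK) ∞
      (fun v : TangentBundle 𝓘(ℝ, EM) M => form v.1 v.2))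
    (vertical : ∀ (p : M) (ξ : EK),
      form p (modelDeriv 𝓘(ℝ, EK) 𝓘(ℝ, EM) (fun k : K => p <• k) 1 ξ) = ξ)
    (act : ∀ (p : M) (k : K) (v : EM),
      form (p <• k) (modelDeriv 𝓘(ℝ, EM) 𝓘(ℝ, EM) (fun q : M => q <• k) p v)
        = modelAd EK k⁻¹ (form p v))
    (smul : ∀ (g : G) (p : M) (v : EM),
      form (g • p) (modelDeriv 𝓘(ℝ, EM) 𝓘(ℝ, EM) (fun q : M => g • q) p v) = form p v) :
    GConnection G EK K EM M where
  form := form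
  smooth := smooth
  vertical p ξ := by
    have h : form (p <• (1 : K))
        (modelDeriv 𝓘(ℝ, EK) 𝓘(ℝ, EM) (fun k : K => p <• k) 1 ξ) = ξ := by
      rw [act_one]; exact vertical p ξ
    exact h
  equivariant := act
  invariant := smul

end GConnection

end Connections

/-! ### Consequences of the splitting -/

section Splitting

variable {EA A EB B EC C : Type*}
  [NormedAddCommGroup EA] [NormedSpace ℝ EA] [TopologicalSpace A] [ChartedSpace EA A] [CommGroup A]
  [NormedAddCommGroup EB] [NormedSpace ℝ EB] [TopologicalSpace B] [ChartedSpace EB B] [Group B]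
  [NormedAddCommGroup EC] [NormedSpace ℝ EC] [TopologicalSpace C] [ChartedSpace EC C] [Group C]

namespace LieCentralExtension

theorem β_α (𝓔 : LieCentralExtension EA A EB B EC C) (a : A) : 𝓔.β (𝓔.α a) = 1 := by
  have : 𝓔.α a ∈ 𝓔.β.ker := 𝓔.exact ▸ ⟨a, rfl⟩
  exact this

theorem exists_α_eq (𝓔 : LieCentralExtension EA A EB B EC C) {b : B} (hb : 𝓔.β b = 1) :
    ∃ a, 𝓔.α a = b := by
  have : b ∈ 𝓔.α.range := by rw [𝓔.exact]; exact hb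
  exact this

theorem exists_mul_α_eq (𝓔 : LieCentralExtension EA A EB B EC C) {b b' : B}
    (h : 𝓔.β b = 𝓔.β b') : ∃ a, b * 𝓔.α a = b' := by
  obtain ⟨a, ha⟩ := 𝓔.exists_α_eq (b := b⁻¹ * b') (by rw [map_mul, map_inv, h, inv_mul_cancel])
  exact ⟨a, by rw [ha, mul_inv_cancel_left]⟩

/-- The inverse of `α : A → α(A)` extends to a map on `B` that is smooth near `α(A)`. -/
theorem exists_smooth_leftInverse_α (𝓔 : LieCentralExtension EA A EB B EC C)
    [LieGroup 𝓘(ℝ, EA) ∞ A] :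
    ∃ l : B → A, (∀ a, l (𝓔.α a) = a) ∧
      ∀ a, ContMDiffAt 𝓘(ℝ, EB) 𝓘(ℝ, EA) ∞ l (𝓔.α a) := by
  let _ : MulAction Aᵐᵒᵖ B := restrictRightAction 𝓔.α
  obtain ⟨U, κ, τ, h1, g⟩ := 𝓔.isPrincipalBundle.exists_gauge (𝓔.β 1)
  refine ⟨fun b => (κ 1)⁻¹ * κ b, fun a => ?_, fun a => ?_⟩
  · have h := g.coord_act 1 h1 a
    have e : (1 : B) <• a = 𝓔.α a := one_mul _
    rw [e] at h
    simp only [h, inv_mul_cancel_left]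
  · refine (contMDiff_mul_left _).comp _ (g.smooth_coord _ ?_)
    rw [β_α]; simpa using h1

theorem exists_smooth_section_β (𝓔 : LieCentralExtension EA A EB B EC C) (c : C) :
    ∃ (V : Set C) (τ : C → B), IsOpen V ∧ c ∈ V ∧
      (∀ y ∈ V, ContMDiffAt 𝓘(ℝ, EC) 𝓘(ℝ, EB) ∞ τ y) ∧ ∀ y ∈ V, 𝓔.β (τ y) = y := by
  let _ : MulAction Aᵐᵒᵖ B := restrictRightAction 𝓔.α
  obtain ⟨U, κ, τ, h1, g⟩ := 𝓔.isPrincipalBundle.exists_gauge c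
  exact ⟨U, τ, g.isOpen, h1, g.smooth_section, g.proj_section⟩

/-- `α_*` on model spaces. -/
noncomputable def modelα (𝓔 : LieCentralExtension EA A EB B EC C) : EA →L[ℝ] EB := 𝓔.dα

/-- `β_*` on model spaces. -/
noncomputable def modelβ (𝓔 : LieCentralExtension EA A EB B EC C) : EB →L[ℝ] EC := 𝓔.dβ

variable {𝓔 : LieCentralExtension EA A EB B EC C}

theorem modelβ_modelα (η : EA) : 𝓔.modelβ (𝓔.modelα η) = 0 := by
  have h := modelDeriv_comp (g := 𝓔.β) (f := 𝓔.α) (x := 1)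
    (𝓔.contMDiff_β _) (𝓔.contMDiff_α _) η
  have e : (fun a => 𝓔.β (𝓔.α a)) = fun _ => 1 := funext 𝓔.β_α
  rw [e, modelDeriv_const, map_one] at h
  exact h.symm

theorem modelAd_modelα [LieGroup 𝓘(ℝ, EB) ∞ B] (b : B) (η : EA) : modelAd EB b (𝓔.modelα η) = 𝓔.modelα η := by
  have h := modelDeriv_comp (g := fun x : B => b * x * b⁻¹) (f := 𝓔.α) (x := 1)
    (contMDiff_conj _ _) (𝓔.contMDiff_α _) η
  have e : (fun a => b * 𝓔.α a * b⁻¹) = 𝓔.α := by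
    ext a; rw [← 𝓔.central, mul_inv_cancel_right]
  rw [e, map_one] at h
  exact h.symm

theorem modelβ_modelAd [LieGroup 𝓘(ℝ, EB) ∞ B] [LieGroup 𝓘(ℝ, EC) ∞ C] (b : B) (ξ : EB) :
    𝓔.modelβ (modelAd EB b ξ) = modelAd EC (𝓔.β b) (𝓔.modelβ ξ) := by
  have h := modelDeriv_comp (g := 𝓔.β) (f := fun x : B => b * x * b⁻¹) (x := 1)
    (𝓔.contMDiff_β _) (contMDiff_conj _ _) ξ
  have h' := modelDeriv_comp (g := fun y : C => 𝓔.β b * y * (𝓔.β b)⁻¹) (f := 𝓔.β) (x := 1)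
    (contMDiff_conj _ _) (𝓔.contMDiff_β _) ξ
  have e : (fun x : B => 𝓔.β (b * x * b⁻¹)) = fun x => 𝓔.β b * 𝓔.β x * (𝓔.β b)⁻¹ := by
    ext x; simp
  rw [e, h', map_one, mul_one, mul_inv_cancel] at h
  exact h.symm

namespace AdSplitting

/-- The section `s` on model spaces. -/
def modelS (S : 𝓔.AdSplitting) : EC →L[ℝ] EB := S.s

/-- The projection `t` on model spaces, as a continuous linear map. -/
noncomputable def modelT [FiniteDimensional ℝ EB] (S : 𝓔.AdSplitting) : EB →L[ℝ] EA :=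
  LinearMap.toContinuousLinearMap (show EB →ₗ[ℝ] EA from S.t)

theorem modelβ_modelS (S : 𝓔.AdSplitting) (ξ : EC) : 𝓔.modelβ (S.modelS ξ) = ξ := S.dβ_s ξ

theorem modelS_modelAd (S : 𝓔.AdSplitting) (b : B) (ξ : EC) :
    S.modelS (modelAd EC (𝓔.β b) ξ) = modelAd EB b (S.modelS ξ) := S.equivariant b ξ

variable [LieGroup 𝓘(ℝ, EA) ∞ A]

theorem modelα_modelT [FiniteDimensional ℝ EB] (S : 𝓔.AdSplitting) (ξ : EB) :
    𝓔.modelα (S.modelT ξ) + S.modelS (𝓔.modelβ ξ) = ξ := S.dα_t ξ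

theorem modelα_injective : Function.Injective 𝓔.modelα := (infinitesimal_exactness 𝓔).1

theorem modelT_modelα [FiniteDimensional ℝ EB] (S : 𝓔.AdSplitting) (η : EA) : S.modelT (𝓔.modelα η) = η := by
  have h := S.modelα_modelT (𝓔.modelα η)
  rw [modelβ_modelα, map_zero, add_zero] at h
  exact modelα_injective h

theorem modelT_modelS [FiniteDimensional ℝ EB] (S : 𝓔.AdSplitting) (ξ : EC) : S.modelT (S.modelS ξ) = 0 := by
  have h := S.modelα_modelT (S.modelS ξ)
  rw [modelβ_modelS, add_eq_right] at h
  exact modelα_injective (h.trans (map_zero _).symm)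

/-- `t` is `Ad`-invariant, because `s β_*` is `Ad`-equivariant and `B` acts trivially on `𝔞`. -/
theorem modelT_modelAd [FiniteDimensional ℝ EB] [LieGroup 𝓘(ℝ, EB) ∞ B]
    [LieGroup 𝓘(ℝ, EC) ∞ C] (S : 𝓔.AdSplitting) (b : B) (ξ : EB) :
    S.modelT (modelAd EB b ξ) = S.modelT ξ := by
  apply modelα_injective (𝓔 := 𝓔)
  have h1 := S.modelα_modelT (modelAd EB b ξ)
  have h2 := congrArg (modelAd EB b) (S.modelα_modelT ξ)
  rw [map_add, modelAd_modelα, ← modelS_modelAd, ← modelβ_modelAd] at h2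
  exact add_right_cancel (h1.trans h2.symm)

end AdSplitting

end LieCentralExtension

end Splitting

section DifferenceForm

variable {EA A EB B EC C EP P EM HM M : Type*}
  [NormedAddCommGroup EA] [NormedSpace ℝ EA] [TopologicalSpace A] [ChartedSpace EA A] [CommGroup A]
  [NormedAddCommGroup EB] [NormedSpace ℝ EB] [TopologicalSpace B] [ChartedSpace EB B] [Group B]
  [NormedAddCommGroup EC] [NormedSpace ℝ EC] [TopologicalSpace C] [ChartedSpace EC C] [Group C]
  [NormedAddCommGroup EP] [NormedSpace ℝ EP] [TopologicalSpace P] [ChartedSpace EP P]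
  [NormedAddCommGroup EM] [NormedSpace ℝ EM] [TopologicalSpace HM]
  [TopologicalSpace M] [ChartedSpace HM M] [FiniteDimensional ℝ EB]
  {I : ModelWithCorners ℝ EM HM}

/-- The pullback of the difference form along `g` depends only on the `B`-component of `g`. -/
theorem differenceForm_pullback {𝓔 : LieCentralExtension EA A EB B EC C} (S : 𝓔.AdSplitting)
    {g : M → P × P × B} {z : M}
    (hg : ContMDiffAt I (𝓘(ℝ, EP).prod (𝓘(ℝ, EP).prod 𝓘(ℝ, EB))) ∞ g z) (v : EM) :
    (show EA from differenceForm S (g z)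
      (modelDeriv I (𝓘(ℝ, EP).prod (𝓘(ℝ, EP).prod 𝓘(ℝ, EB))) g z v))
      = S.modelT (modelMaurerCartan EB (g z).2.2
          (modelDeriv I 𝓘(ℝ, EB) (fun w => (g w).2.2) z v)) := by
  have h : ContMDiffAt (𝓘(ℝ, EP).prod (𝓘(ℝ, EP).prod 𝓘(ℝ, EB))) 𝓘(ℝ, EB) ∞
      (fun z : P × P × B => z.2.2) (g z) :=
    contMDiffAt_snd.comp (f := fun z : P × P × B => z.2) _ contMDiffAt_snd
  rw [modelDeriv_comp (g := fun z : P × P × B => z.2.2) (f := g) h hg]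
  rfl

end DifferenceForm

/-! ### From central extensions to triples -/

section ConnectionDifference

variable {G EK K EM M EX X : Type*}
  [NormedAddCommGroup EK] [NormedSpace ℝ EK] [TopologicalSpace K] [ChartedSpace EK K] [Group K]
  [NormedAddCommGroup EM] [NormedSpace ℝ EM] [TopologicalSpace M] [ChartedSpace EM M]
  [NormedAddCommGroup EX] [NormedSpace ℝ EX] [TopologicalSpace X] [ChartedSpace EX X]
  [IsManifold 𝓘(ℝ, EM) ∞ M] [Group G] [MulAction Kᵐᵒᵖ M] [MulAction G M]

/-- The pullbacks of a connection along the two projections of `M ×_X M` differ by the adjoint action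
and the Maurer-Cartan form of the difference map `γ`, where `p γ(p, q) = q`. -/
theorem GConnection.onModel_snd [LieGroup 𝓘(ℝ, EK) ∞ K] {π : M → X}
    (h : IsPrincipalBundle EK K EM M EX X π) (ϖ : GConnection G EK K EM M)
    {z : M × M} (hz : z ∈ FibreSquare π) {γ : M × M → K}
    (hγ : ContMDiffAt (𝓘(ℝ, EM).prod 𝓘(ℝ, EM)) 𝓘(ℝ, EK) ∞ γ z)
    (hγz : ∀ᶠ w in nhds z, w ∈ FibreSquare π → w.1 <• γ w = w.2) {v : EM × EM}
    (hv : modelDeriv 𝓘(ℝ, EM) 𝓘(ℝ, EX) π z.1 v.1 = modelDeriv 𝓘(ℝ, EM) 𝓘(ℝ, EX) π z.2 v.2) :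
    ϖ.onModel z.2 v.2 = modelAd EK (γ z)⁻¹ (ϖ.onModel z.1 v.1)
      + modelMaurerCartan EK (γ z)
        (modelDeriv (𝓘(ℝ, EM).prod 𝓘(ℝ, EM)) 𝓘(ℝ, EK) γ z v) := by
  obtain ⟨F, hF, hFz, hFm, hF1, hFv⟩ := h.exists_retraction hz hv
  have hz2 : z.1 <• γ z = z.2 := hγz.self_of_nhds hz
  have hγF : ContMDiffAt (𝓘(ℝ, EM).prod 𝓘(ℝ, EM)) 𝓘(ℝ, EK) ∞ (fun w => γ (F w)) z :=
    ContMDiffAt.comp (g := γ) (f := F) z (by rwa [hFz]) hF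
  have hpair : ContMDiffAt (𝓘(ℝ, EM).prod 𝓘(ℝ, EM)) (𝓘(ℝ, EM).prod 𝓘(ℝ, EK)) ∞
      (fun w => (w.1, γ (F w))) z := contMDiffAt_fst.prodMk hγF
  -- on the image of the retraction `F` the second point is the first one times `γ`
  have key : (fun w => (F w).2) =ᶠ[nhds z] fun w => w.1 <• γ (F w) := by
    have ht : Filter.Tendsto F (nhds z) (nhds z) := by
      have := hF.continuousAt.tendsto
      rwa [hFz] at this
    filter_upwards [hFm, ht.eventually hγz] with w h1 h2
    rw [← h2 h1, hF1]
  have e1 : modelDeriv (𝓘(ℝ, EM).prod 𝓘(ℝ, EM)) 𝓘(ℝ, EM) (fun w => (F w).2) z v = v.2 := by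
    rw [modelDeriv_comp (g := Prod.snd) (f := F) contMDiffAt_snd hF, hFv]
    exact modelDeriv_snd _ _
  have e2 : modelDeriv (𝓘(ℝ, EM).prod 𝓘(ℝ, EM)) 𝓘(ℝ, EK) (fun w => γ (F w)) z v
      = modelDeriv (𝓘(ℝ, EM).prod 𝓘(ℝ, EM)) 𝓘(ℝ, EK) γ z v := by
    rw [modelDeriv_comp (g := γ) (f := F) (by rwa [hFz]) hF, hFv, hFz]
  rw [modelDeriv_congr key, modelDeriv_comp (g := fun y : M × K => y.1 <• y.2)
    (f := fun w => (w.1, γ (F w))) (h.contMDiff_act _) hpair,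
    modelDeriv_prodMk contMDiffAt_fst hγF, modelDeriv_prod (h.contMDiff_act _), modelDeriv_fst, e2,
    hFz] at e1
  have e3 := congrArg (ϖ.onModel (z.1 <• γ z)) e1
  rw [map_add] at e3
  rw [← hz2, ← e3]
  exact congrArg₂ (· + ·) (ϖ.onModel_act _ _ _) (ϖ.onModel_orbit h _ _ _)

end ConnectionDifference

section ExtensionToTriple

variable {EG G EA A EB B EC C EX X EP P ER R : Type*}
  [NormedAddCommGroup EG] [NormedSpace ℝ EG] [TopologicalSpace G] [ChartedSpace EG G] [Group G]
  [NormedAddCommGroup EA] [NormedSpace ℝ EA] [TopologicalSpace A] [ChartedSpace EA A] [CommGroup A]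
  [LieGroup 𝓘(ℝ, EA) ∞ A]
  [NormedAddCommGroup EB] [NormedSpace ℝ EB] [TopologicalSpace B] [ChartedSpace EB B] [Group B]
  [LieGroup 𝓘(ℝ, EB) ∞ B]
  [NormedAddCommGroup EC] [NormedSpace ℝ EC] [TopologicalSpace C] [ChartedSpace EC C] [Group C]
  [LieGroup 𝓘(ℝ, EC) ∞ C]
  [NormedAddCommGroup EX] [NormedSpace ℝ EX] [TopologicalSpace X] [ChartedSpace EX X]
  [NormedAddCommGroup EP] [NormedSpace ℝ EP] [TopologicalSpace P] [ChartedSpace EP P]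
  [MulAction Cᵐᵒᵖ P]
  [NormedAddCommGroup ER] [NormedSpace ℝ ER] [TopologicalSpace R] [ChartedSpace ER R]
  [MulAction Bᵐᵒᵖ R]

/-- A `B`-bundle `R → X` that maps `β`-equivariantly to the `C`-bundle `P → X` is an `A`-bundle
over `P`: a local section of `R → P` is the product of a local section of `R → X` and of a lift along
`β` of the `C`-valued difference between its image in `P` and the given point. -/
theorem IsPrincipalBundle.restrict (𝓔 : LieCentralExtension EA A EB B EC C) {π : P → X} {σ : R → P}
    (hP : IsPrincipalBundle EC C EP P EX X π) (hR : IsPrincipalBundle EB B ER R EX X (π ∘ σ))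
    (hσ : ContMDiff 𝓘(ℝ, ER) 𝓘(ℝ, EP) ∞ σ) (hσB : ∀ (r : R) (b : B), σ (r <• b) = σ r <• 𝓔.β b) :
    letI : MulAction Aᵐᵒᵖ R := restrictRightAction 𝓔.α
    IsPrincipalBundle EA A ER R EP P σ := by
  let _ : MulAction Aᵐᵒᵖ R := restrictRightAction 𝓔.α
  have hA : ∀ (r : R) (a : A), r <• a = r <• 𝓔.α a := fun _ _ => rfl
  refine IsPrincipalBundle.of_gauges ?_ (fun r a => ?_) hσ (fun p₀ => ?_)
  · exact hR.contMDiff_act.comp (g := fun z : R × B => z.1 <• z.2)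
      (f := fun z : R × A => (z.1, 𝓔.α z.2))
      (contMDiff_fst.prodMk (𝓔.contMDiff_α.comp contMDiff_snd))
  · rw [hA, hσB, 𝓔.β_α, act_one]
  obtain ⟨U, κR, τR, hxU, gR⟩ := hR.exists_gauge (π p₀)
  obtain ⟨U', κP, τP, hxU', gP⟩ := hP.exists_gauge (π p₀)
  obtain ⟨l, hl, hls⟩ := 𝓔.exists_smooth_leftInverse_α
  set c : P → C := fun p => (κP (σ (τR (π p))))⁻¹ * κP p with hc
  obtain ⟨V, τβ, hV, hcV, sβ, hβ⟩ := 𝓔.exists_smooth_section_β (c p₀)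
  have hπσ : ∀ p, π p ∈ U → π (σ (τR (π p))) = π p := fun p hp => gR.proj_section _ hp
  have hcp : ∀ p, π p ∈ U → π p ∈ U' → σ (τR (π p)) <• c p = p := fun p hp hp' =>
    gP.act_div (by rwa [hπσ p hp]) (hπσ p hp)
  have sτ : ∀ p, π p ∈ U → ContMDiffAt 𝓘(ℝ, EP) 𝓘(ℝ, ER) ∞ (fun p => τR (π p)) p := fun p hp =>
    (gR.smooth_section _ hp).comp p (hP.contMDiff_proj p)
  have sc : ∀ p, π p ∈ U → π p ∈ U' → ContMDiffAt 𝓘(ℝ, EP) 𝓘(ℝ, EC) ∞ c p := fun p hp hp' =>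
    (((gP.smooth_coord _ (by rwa [hπσ p hp])).comp (f := fun p => σ (τR (π p))) p
      ((hσ _).comp (f := fun p => τR (π p)) p (sτ p hp))).inv).mul (gP.smooth_coord _ hp')
  set O : Set P := π ⁻¹' (U ∩ U') with hO
  have hOo : IsOpen O := (gR.isOpen.inter gP.isOpen).preimage hP.contMDiff_proj.continuous
  have hW : IsOpen (O ∩ c ⁻¹' V) := ContinuousOn.isOpen_inter_preimage
    (fun p hp => (sc p hp.1 hp.2).continuousAt.continuousWithinAt) hOo hV
  -- the coordinate of `r` with respect to `τR` is mapped by `β` to that of `σ r`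
  have hβκ : ∀ r, σ r ∈ O → 𝓔.β (κR r) = c (σ r) := fun r hr => by
    have h1 := congrArg σ (gR.section_act_coord r hr.1)
    rw [hσB] at h1
    exact hP.act_injective _ (h1.trans (hcp _ hr.1 hr.2).symm)
  have hker : ∀ r, σ r ∈ O → c (σ r) ∈ V → ∃ a, 𝓔.α a = (τβ (c (σ r)))⁻¹ * κR r :=
    fun r hr hr' => 𝓔.exists_α_eq (by
      rw [map_mul, map_inv, hβ _ hr', hβκ r hr, inv_mul_cancel])
  have hτ : ∀ p, π p ∈ U → π p ∈ U' → c p ∈ V → σ (τR (π p) <• τβ (c p)) = p :=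
    fun p h1 h2 h3 => by rw [hσB, hβ _ h3, hcp p h1 h2]
  have sτβ : ∀ p, π p ∈ U → π p ∈ U' → c p ∈ V →
      ContMDiffAt 𝓘(ℝ, EP) 𝓘(ℝ, EB) ∞ (fun p => τβ (c p)) p := fun p h1 h2 h3 =>
    (sβ _ h3).comp p (sc p h1 h2)
  refine ⟨O ∩ c ⁻¹' V, fun r => l ((τβ (c (σ r)))⁻¹ * κR r), fun p => τR (π p) <• τβ (c p),
    ⟨⟨hxU, hxU'⟩, hcV⟩, hW, ?_, ?_, ?_, ?_, ?_, ?_⟩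
  · rintro r ⟨⟨h1, h2⟩, h3⟩
    obtain ⟨a, ha⟩ := hker r ⟨h1, h2⟩ h3
    refine ContMDiffAt.comp (g := l) (f := fun r => (τβ (c (σ r)))⁻¹ * κR r) r (ha ▸ hls a) ?_
    exact (((sτβ _ h1 h2 h3).comp (f := σ) r (hσ r)).inv).mul (gR.smooth_coord r h1)
  · rintro p ⟨⟨h1, h2⟩, h3⟩
    exact ContMDiffAt.comp (g := fun z : R × B => z.1 <• z.2)
      (f := fun p => (τR (π p), τβ (c p))) p (hR.contMDiff_act _)
      ((sτ p h1).prodMk (sτβ p h1 h2 h3))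
  · rintro p ⟨⟨h1, h2⟩, h3⟩
    exact hτ p h1 h2 h3
  · rintro p ⟨⟨h1, h2⟩, h3⟩
    simp only [hτ p h1 h2 h3]
    rw [gR.coord_act _ (by rw [Function.comp_apply, hπσ p h1]; exact h1), gR.coord_section _ h1,
      one_mul, inv_mul_cancel, ← map_one 𝓔.α, hl]
  · rintro r ⟨⟨h1, h2⟩, h3⟩ a
    obtain ⟨a₀, ha₀⟩ := hker r ⟨h1, h2⟩ h3
    simp only [hA, hσB, 𝓔.β_α, act_one]
    rw [gR.coord_act _ h1, ← mul_assoc, ← ha₀, ← map_mul, hl, hl]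
  · rintro r ⟨⟨h1, h2⟩, h3⟩
    obtain ⟨a₀, ha₀⟩ := hker r ⟨h1, h2⟩ h3
    simp only [hA]
    rw [← ha₀, hl, ha₀, act_act, mul_inv_cancel_left]
    exact gR.section_act_coord r h1

/-- The difference map `(r₁, r₂) ↦ b`, `r₁ b = r₂`, of a principal bundle has local smooth
extensions. -/
theorem IsPrincipalBundle.smoothOnSubset_div {ρ : R → X} (hR : IsPrincipalBundle EB B ER R EX X ρ) :
    SmoothOnSubset (𝓘(ℝ, ER).prod 𝓘(ℝ, ER)) 𝓘(ℝ, EB)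
      (fun z : FibreSquare ρ => hR.div z.2) := by
  rintro ⟨z, hz⟩
  obtain ⟨U, κ, τ, hx, g⟩ := hR.exists_gauge (ρ z.1)
  have hz' : ρ z.1 = ρ z.2 := hz
  have ho : IsOpen (ρ ⁻¹' U) := g.isOpen.preimage hR.contMDiff_proj.continuous
  refine ⟨fun w => (κ w.1)⁻¹ * κ w.2, (ρ ⁻¹' U) ×ˢ (ρ ⁻¹' U), ho.prod ho,
    ⟨hx, by rw [Set.mem_preimage, ← hz']; exact hx⟩, ?_, ?_⟩
  · rintro w ⟨h1, h2⟩
    exact ((((g.smooth_coord _ h1).comp (f := Prod.fst) w contMDiffAt_fst).inv).mul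
      ((g.smooth_coord _ h2).comp (f := Prod.snd) w contMDiffAt_snd)).contMDiffWithinAt
  · rintro ⟨w, hw⟩ hwU
    exact (hR.div_eq hw (g.act_div hwU.1 hw)).symm

end ExtensionToTriple

namespace AdmissibleExtension

universe u

variable {EG G EA A EB B EC C EX X EP P ER : Type*}
  [NormedAddCommGroup EG] [NormedSpace ℝ EG] [TopologicalSpace G] [ChartedSpace EG G] [Group G]
  [NormedAddCommGroup EA] [NormedSpace ℝ EA] [TopologicalSpace A] [ChartedSpace EA A] [CommGroup A]
  [NormedAddCommGroup EB] [NormedSpace ℝ EB] [TopologicalSpace B] [ChartedSpace EB B] [Group B]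
  [NormedAddCommGroup EC] [NormedSpace ℝ EC] [TopologicalSpace C] [ChartedSpace EC C] [Group C]
  [NormedAddCommGroup EX] [NormedSpace ℝ EX] [TopologicalSpace X] [ChartedSpace EX X]
  [NormedAddCommGroup EP] [NormedSpace ℝ EP] [TopologicalSpace P] [ChartedSpace EP P]
  [IsManifold 𝓘(ℝ, EP) ∞ P]
  [MulAction Cᵐᵒᵖ P] [MulAction G X] [MulAction G P]
  [NormedAddCommGroup ER] [NormedSpace ℝ ER]
  {𝓔 : LieCentralExtension EA A EB B EC C}
  {π : P → X} {hπ : IsEquivariantBundle EG G EC C EP P EX X π} {ωπ : GConnection G EC C EP P}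

theorem isPrincipalBundle (E : AdmissibleExtension.{u} ER 𝓔 hπ ωπ) :
    IsPrincipalBundle EB B ER E.R EX X (π ∘ E.σ) := by
  have h : π ∘ E.σ = E.ρ := funext E.π_σ
  rw [h]
  exact E.isBundle.isPrincipalBundle

theorem modelβ_onModel (E : AdmissibleExtension.{u} ER 𝓔 hπ ωπ) (r : E.R) (v : ER) :
    𝓔.modelβ (E.ωρ.onModel r v)
      = ωπ.onModel (E.σ r) (modelDeriv 𝓘(ℝ, ER) 𝓘(ℝ, EP) E.σ r v) :=
  E.admissible r v

/-- The difference map of the `B`-bundle `ρ` as a map to the difference bundle `Q_P`. -/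
noncomputable def difference (E : AdmissibleExtension.{u} ER 𝓔 hπ ωπ)
    (z : FibreSquare (π ∘ E.σ)) : DifferenceBundle 𝓔 π where
  p₁ := E.σ z.1.1
  p₂ := E.σ z.1.2
  b := E.isPrincipalBundle.div z.2
  same_fibre := z.2
  lifts := (E.σ_act _ _).symm.trans (congrArg E.σ (E.isPrincipalBundle.act_div z.2))

theorem act_difference (E : AdmissibleExtension.{u} ER 𝓔 hπ ωπ) (z : FibreSquare (π ∘ E.σ)) :
    z.1.1 <• (E.difference z).b = z.1.2 :=
  E.isPrincipalBundle.act_div z.2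

theorem difference_eq (E : AdmissibleExtension.{u} ER 𝓔 hπ ωπ) (z : FibreSquare (π ∘ E.σ)) {b : B}
    (hb : z.1.1 <• b = z.1.2) : (E.difference z).b = b :=
  E.isPrincipalBundle.div_eq z.2 hb

variable [LieGroup 𝓘(ℝ, EA) ∞ A] [LieGroup 𝓘(ℝ, EB) ∞ B] [LieGroup 𝓘(ℝ, EC) ∞ C]
  [FiniteDimensional ℝ EB]

/-- The connection `t ∘ ω^ρ` on the `A`-bundle `σ : R → P`. -/
noncomputable def tConnection (E : AdmissibleExtension.{u} ER 𝓔 hπ ωπ) (S : 𝓔.AdSplitting) :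
    letI : MulAction Aᵐᵒᵖ E.R := restrictRightAction 𝓔.α
    GConnection G EA A ER E.R :=
  letI : MulAction Aᵐᵒᵖ E.R := restrictRightAction 𝓔.α
  GConnection.ofModel (fun r => S.modelT.comp (E.ωρ.onModel r))
    (S.modelT.contMDiff.comp E.ωρ.smooth_onModel)
    (fun r η => by
      have e : (fun a : A => r <• a) = fun a : A => r <• 𝓔.α a := rfl
      rw [e, modelDeriv_comp (g := fun b : B => r <• b) (f := 𝓔.α)
        (E.isPrincipalBundle.contMDiff_orbit _ _) (𝓔.contMDiff_α _), map_one,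
        ContinuousLinearMap.comp_apply, E.ωρ.onModel_vertical]
      exact S.modelT_modelα η)
    (fun r a v => by
      rw [modelAd_of_central (mul_comm _), ContinuousLinearMap.comp_apply,
        ContinuousLinearMap.comp_apply]
      have h := E.ωρ.onModel_act r (𝓔.α a) v
      rw [modelAd_of_central (fun b => by rw [← map_inv, 𝓔.central])] at h
      exact congrArg S.modelT h)
    (fun g r v => congrArg S.modelT (E.ωρ.onModel_smul g r v))

/-- The triple of a central extension, on the same total space. -/
noncomputable def toTriple (E : AdmissibleExtension.{u} ER 𝓔 hπ ωπ) (S : 𝓔.AdSplitting) :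
    DescentTriple.{u} ER S hπ :=
  letI : MulAction Aᵐᵒᵖ E.R := restrictRightAction 𝓔.α
  have hA : ∀ (r : E.R) (a : A), r <• a = r <• 𝓔.α a := fun _ _ => rfl
  { R := E.R
    σ := E.σ
    isBundle :=
      { isPrincipalBundle := hπ.isPrincipalBundle.restrict 𝓔 E.isPrincipalBundle
          E.contMDiff_σ E.σ_act
        contMDiff_smul := E.isBundle.contMDiff_smul
        smul_act := fun g r a => E.isBundle.smul_act g r (𝓔.α a)
        map_smul := E.σ_smul }
    ωσ := E.tConnection S
    ψ := Quotient.lift E.difference (by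
      rintro z w ⟨a, h₁, h₂⟩
      have hσ : ∀ (r : E.R), E.σ (r <• a) = E.σ r := fun r => by
        rw [hA, E.σ_act, 𝓔.β_α, act_one]
      refine DifferenceBundle.ext ?_ ?_ ?_
      · change E.σ z.1.1 = E.σ w.1.1
        rw [h₁, hσ]
      · change E.σ z.1.2 = E.σ w.1.2
        rw [h₂, hσ]
      · refine (E.difference_eq w ?_).symm
        rw [h₁, h₂, hA, hA, act_act, 𝓔.central, ← act_act, E.act_difference])
    smooth_ψ := fun z => by
      obtain ⟨γ, U, hU, hz, hγ, hγd⟩ := E.isPrincipalBundle.smoothOnSubset_div z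
      refine ⟨fun w => (E.σ w.1, E.σ w.2, γ w), U, hU, hz, ?_, fun y hy => ?_⟩
      · exact (E.contMDiff_σ.comp contMDiff_fst).contMDiffOn.prodMk
          ((E.contMDiff_σ.comp contMDiff_snd).contMDiffOn.prodMk hγ)
      · exact congrArg (fun b => (E.σ y.1.1, E.σ y.1.2, b)) (hγd y hy)
    ψ_fst := fun _ => rfl
    ψ_snd := fun _ => rfl
    ψ_act := fun r₁ r₂ a h h' => by
      refine DifferenceBundle.ext rfl ?_ ?_
      · change E.σ (r₂ <• a) = E.σ r₂
        rw [hA, E.σ_act, 𝓔.β_α, act_one]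
      · refine E.difference_eq ⟨_, h'⟩ ?_
        exact (act_act r₁ _ (𝓔.α a)).symm.trans
          (congrArg (fun r => r <• 𝓔.α a) (E.act_difference ⟨_, h⟩))
    ψ_smul := fun g r₁ r₂ h h' => by
      refine DifferenceBundle.ext (E.σ_smul g r₁) (E.σ_smul g r₂) ?_
      refine E.difference_eq ⟨_, h'⟩ ((E.isBundle.smul_act g r₁ _).symm.trans ?_)
      exact congrArg (fun r => g • r) (E.act_difference ⟨_, h⟩)
    cocycle := fun r₁ r₂ r₃ h₁₂ h₂₃ h₁₃ => by
      refine DifferenceBundle.ext rfl rfl ?_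
      refine (E.difference_eq ⟨_, h₁₃⟩ ((act_act _ _ _).symm.trans ?_)).symm
      exact (congrArg (fun r : E.R => r <• (E.difference ⟨_, h₂₃⟩).b)
        (E.act_difference ⟨_, h₁₂⟩)).trans (E.act_difference ⟨_, h₂₃⟩)
    connection_eq := fun z g hg v hv => by
      obtain ⟨U, hU, hz, hgU, hgψ⟩ := hg
      have hgz := hgU.contMDiffAt (hU.mem_nhds hz)
      have hγ : ContMDiffAt (𝓘(ℝ, ER).prod 𝓘(ℝ, ER)) 𝓘(ℝ, EB) ∞ (fun w => (g w).2.2) z.1 :=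
        contMDiffAt_snd.comp (f := fun w => (g w).2) _ (contMDiffAt_snd.comp (f := g) _ hgz)
      have hγz : ∀ᶠ w in nhds z.1, w ∈ FibreSquare (π ∘ E.σ) → w.1 <• (g w).2.2 = w.2 := by
        filter_upwards [hU.mem_nhds hz] with w hw hw'
        rw [hgψ ⟨w, hw'⟩ hw]
        exact E.isPrincipalBundle.act_div hw'
      have hs := E.isPrincipalBundle.contMDiff_proj
      have hv' : modelDeriv 𝓘(ℝ, ER) 𝓘(ℝ, EX) (π ∘ E.σ) z.1.1 v.1
          = modelDeriv 𝓘(ℝ, ER) 𝓘(ℝ, EX) (π ∘ E.σ) z.1.2 v.2 := by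
        have h1 := modelDeriv_comp (g := π ∘ E.σ) (f := Prod.fst) (x := z.1)
          (hs _) (contMDiffAt_fst (I := 𝓘(ℝ, ER)) (J := 𝓘(ℝ, ER))) v
        have h2 := modelDeriv_comp (g := π ∘ E.σ) (f := Prod.snd) (x := z.1)
          (hs _) (contMDiffAt_snd (I := 𝓘(ℝ, ER)) (J := 𝓘(ℝ, ER))) v
        erw [modelDeriv_fst] at h1
        erw [modelDeriv_snd] at h2
        exact h1.symm.trans (Eq.trans hv h2)
      have key := congrArg S.modelT (E.ωρ.onModel_snd E.isPrincipalBundle z.2 hγ hγz hv')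
      rw [map_add, S.modelT_modelAd, ← sub_eq_iff_eq_add'] at key
      refine Eq.trans ?_ (key.trans (differenceForm_pullback S hgz v).symm)
      rw [mfderiv_fst, mfderiv_snd]
      rfl }

end AdmissibleExtension

/-! ### From triples to central extensions -/

open LieCentralExtension

namespace DescentTriple

universe u

variable {EG G EA A EB B EC C EX X EP P ER : Type*}
  [NormedAddCommGroup EG] [NormedSpace ℝ EG] [TopologicalSpace G] [ChartedSpace EG G] [Group G]
  [NormedAddCommGroup EA] [NormedSpace ℝ EA] [TopologicalSpace A] [ChartedSpace EA A] [CommGroup A]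
  [NormedAddCommGroup EB] [NormedSpace ℝ EB] [TopologicalSpace B] [ChartedSpace EB B] [Group B]
  [NormedAddCommGroup EC] [NormedSpace ℝ EC] [TopologicalSpace C] [ChartedSpace EC C] [Group C]
  [NormedAddCommGroup EX] [NormedSpace ℝ EX] [TopologicalSpace X] [ChartedSpace EX X]
  [NormedAddCommGroup EP] [NormedSpace ℝ EP] [TopologicalSpace P] [ChartedSpace EP P]
  [MulAction Cᵐᵒᵖ P] [MulAction G X] [MulAction G P]
  [NormedAddCommGroup ER] [NormedSpace ℝ ER]
  {𝓔 : LieCentralExtension EA A EB B EC C} {S : 𝓔.AdSplitting}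
  {π : P → X} {hπ : IsEquivariantBundle EG G EC C EP P EX X π}

open Classical in
/-- The `B`-component of `ψ[r₁, r₂]`, set to `1` outside `R ×_X R`. -/
noncomputable def gap (T : DescentTriple.{u} ER S hπ) (r₁ r₂ : T.R) : B :=
  if h : (r₁, r₂) ∈ FibreSquare (π ∘ T.σ) then (T.ψ (BorelSquare.mk A ⟨(r₁, r₂), h⟩)).b else 1

section Algebra

variable (T : DescentTriple.{u} ER S hπ) {r₁ r₂ r₃ : T.R}

theorem gap_eq (h : (r₁, r₂) ∈ FibreSquare (π ∘ T.σ)) :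
    T.gap r₁ r₂ = (T.ψ (BorelSquare.mk A ⟨(r₁, r₂), h⟩)).b :=
  dif_pos h

theorem σ_act (r : T.R) (a : A) : T.σ (r <• a) = T.σ r :=
  T.isBundle.isPrincipalBundle.map_act r a

theorem σ_gap (h : π (T.σ r₁) = π (T.σ r₂)) : T.σ r₁ <• 𝓔.β (T.gap r₁ r₂) = T.σ r₂ := by
  have h' : (r₁, r₂) ∈ FibreSquare (π ∘ T.σ) := h
  have e := (T.ψ (BorelSquare.mk A ⟨(r₁, r₂), h'⟩)).lifts
  rw [T.ψ_fst, T.ψ_snd] at e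
  rw [T.gap_eq h']
  exact e

theorem gap_act (h : π (T.σ r₁) = π (T.σ r₂)) (a : A) :
    T.gap r₁ (r₂ <• a) = T.gap r₁ r₂ * 𝓔.α a := by
  have h' : (r₁, r₂) ∈ FibreSquare (π ∘ T.σ) := h
  have h'' : (r₁, r₂ <• a) ∈ FibreSquare (π ∘ T.σ) := by
    change π (T.σ r₁) = π (T.σ (r₂ <• a))
    rwa [T.σ_act]
  rw [T.gap_eq h', T.gap_eq h'', T.ψ_act r₁ r₂ a h' h'']
  rfl

theorem gap_mul (h₁₂ : π (T.σ r₁) = π (T.σ r₂)) (h₂₃ : π (T.σ r₂) = π (T.σ r₃)) :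
    T.gap r₁ r₂ * T.gap r₂ r₃ = T.gap r₁ r₃ := by
  have h₁₂' : (r₁, r₂) ∈ FibreSquare (π ∘ T.σ) := h₁₂
  have h₂₃' : (r₂, r₃) ∈ FibreSquare (π ∘ T.σ) := h₂₃
  have h₁₃' : (r₁, r₃) ∈ FibreSquare (π ∘ T.σ) := h₁₂.trans h₂₃
  rw [T.gap_eq h₁₂', T.gap_eq h₂₃', T.gap_eq h₁₃', ← T.cocycle r₁ r₂ r₃ h₁₂' h₂₃' h₁₃']
  rfl

theorem gap_self (r : T.R) : T.gap r r = 1 :=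
  mul_eq_left.1 (T.gap_mul (r₁ := r) (r₂ := r) (r₃ := r) rfl rfl)

theorem gap_smul (h : π (T.σ r₁) = π (T.σ r₂)) (g : G) :
    T.gap (g • r₁) (g • r₂) = T.gap r₁ r₂ := by
  have h' : (r₁, r₂) ∈ FibreSquare (π ∘ T.σ) := h
  have h'' : (g • r₁, g • r₂) ∈ FibreSquare (π ∘ T.σ) := by
    change π (T.σ (g • r₁)) = π (T.σ (g • r₂))
    rw [T.isBundle.map_smul, T.isBundle.map_smul, hπ.map_smul, hπ.map_smul, h]
  rw [T.gap_eq h', T.gap_eq h'', T.ψ_smul g r₁ r₂ h' h'']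
  rfl

/-- `B` acts freely: equal `B`-components give the same point of `P`, and then `ψ` is an
`A`-homomorphism with `α` injective. -/
theorem eq_of_gap_eq (h₁₂ : π (T.σ r₁) = π (T.σ r₂)) (h₁₃ : π (T.σ r₁) = π (T.σ r₃))
    (h : T.gap r₁ r₂ = T.gap r₁ r₃) : r₂ = r₃ := by
  have hσ : T.σ r₂ = T.σ r₃ := by rw [← T.σ_gap h₁₂, ← T.σ_gap h₁₃, h]
  obtain ⟨a, rfl⟩ := T.isBundle.isPrincipalBundle.exists_act_eq hσ
  rw [T.gap_act h₁₂, left_eq_mul, ← map_one 𝓔.α] at h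
  rw [𝓔.injective h, act_one]

/-- Any point over `σ(r) β(b)` has the right `B`-component up to an element of `α(A)`, which the
`A`-action corrects. -/
theorem exists_gap_eq (r : T.R) (b : B) :
    ∃ r' : T.R, π (T.σ r) = π (T.σ r') ∧ T.gap r r' = b := by
  obtain ⟨U, κ, τ, hx, g⟩ := T.isBundle.isPrincipalBundle.exists_gauge (T.σ r <• 𝓔.β b)
  have h1 : T.σ (τ (T.σ r <• 𝓔.β b)) = T.σ r <• 𝓔.β b := g.proj_section _ hx
  have h2 : π (T.σ r) = π (T.σ (τ (T.σ r <• 𝓔.β b))) := by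
    rw [h1, hπ.isPrincipalBundle.map_act]
  have h3 := hπ.isPrincipalBundle.act_injective _ ((T.σ_gap h2).trans h1)
  obtain ⟨a, ha⟩ := 𝓔.exists_mul_α_eq h3
  exact ⟨τ (T.σ r <• 𝓔.β b) <• a, by rwa [T.σ_act], by rw [T.gap_act h2, ha]⟩

/-- The translate `r b` of `r ∈ R` by `b ∈ B`, characterized by `ψ[r, r b] = (σ r, σ(r) β(b), b)`. -/
noncomputable def translate (r : T.R) (b : B) : T.R := (T.exists_gap_eq r b).choose

theorem proj_translate (r : T.R) (b : B) : π (T.σ (T.translate r b)) = π (T.σ r) :=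
  (T.exists_gap_eq r b).choose_spec.1.symm

theorem gap_translate (r : T.R) (b : B) : T.gap r (T.translate r b) = b :=
  (T.exists_gap_eq r b).choose_spec.2

theorem translate_eq (h : π (T.σ r₁) = π (T.σ r₂)) {b : B} (hb : T.gap r₁ r₂ = b) :
    T.translate r₁ b = r₂ :=
  T.eq_of_gap_eq (T.proj_translate r₁ b).symm h ((T.gap_translate r₁ b).trans hb.symm)

theorem σ_translate (r : T.R) (b : B) : T.σ (T.translate r b) = T.σ r <• 𝓔.β b := by
  rw [← T.σ_gap (T.proj_translate r b).symm, T.gap_translate]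

theorem translate_α (r : T.R) (a : A) : T.translate r (𝓔.α a) = r <• a :=
  T.translate_eq (by rw [T.σ_act]) (by rw [T.gap_act rfl, T.gap_self, one_mul])

theorem translate_mul (r : T.R) (b b' : B) :
    T.translate r (b * b') = T.translate (T.translate r b) b' :=
  T.translate_eq (by rw [T.proj_translate, T.proj_translate]) (by
    rw [← T.gap_mul (r₂ := T.translate r b) (T.proj_translate r b).symm
      (T.proj_translate _ _).symm, T.gap_translate, T.gap_translate])

theorem smul_translate (g : G) (r : T.R) (b : B) :
    g • T.translate r b = T.translate (g • r) b := by
  have h := (T.proj_translate r b).symm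
  refine (T.translate_eq ?_ ?_).symm
  · rw [T.isBundle.map_smul, T.isBundle.map_smul, hπ.map_smul, hπ.map_smul, h]
  · rw [T.gap_smul h, T.gap_translate]

/-- The right action of `B` on the total space of a triple. -/
noncomputable abbrev actionB : MulAction Bᵐᵒᵖ T.R where
  smul b r := T.translate r b.unop
  one_smul r := T.translate_eq rfl (T.gap_self r)
  mul_smul b b' r := T.translate_mul r b'.unop b.unop

end Algebra

section Smoothness

variable (T : DescentTriple.{u} ER S hπ)

theorem contMDiff_σ : ContMDiff 𝓘(ℝ, ER) 𝓘(ℝ, EP) ∞ T.σ :=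
  T.isBundle.isPrincipalBundle.contMDiff_proj

theorem contMDiff_proj : ContMDiff 𝓘(ℝ, ER) 𝓘(ℝ, EX) ∞ (fun r => π (T.σ r)) :=
  hπ.isPrincipalBundle.contMDiff_proj.comp T.contMDiff_σ

theorem exists_gap_extension {r₁ r₂ : T.R} (h : π (T.σ r₁) = π (T.σ r₂)) :
    ∃ γ : T.R × T.R → B,
      ContMDiffAt (𝓘(ℝ, ER).prod 𝓘(ℝ, ER)) 𝓘(ℝ, EB) ∞ γ (r₁, r₂) ∧
      ∀ᶠ w in nhds (r₁, r₂), π (T.σ w.1) = π (T.σ w.2) → γ w = T.gap w.1 w.2 := by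
  obtain ⟨g, U, hU, hz, hgU, hgψ⟩ := T.smooth_ψ ⟨(r₁, r₂), h⟩
  have hgz := hgU.contMDiffAt (hU.mem_nhds hz)
  refine ⟨fun w => (g w).2.2, contMDiffAt_snd.comp (f := fun w => (g w).2) _
    (contMDiffAt_snd.comp (f := g) _ hgz), ?_⟩
  filter_upwards [hU.mem_nhds hz] with w hw hw'
  have hw'' : w ∈ FibreSquare (π ∘ T.σ) := hw'
  rw [hgψ ⟨w, hw''⟩ hw, T.gap_eq hw'']
  rfl

variable {EN HN N : Type*} [NormedAddCommGroup EN] [NormedSpace ℝ EN] [TopologicalSpace HN]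
  [TopologicalSpace N] [ChartedSpace HN N] {I : ModelWithCorners ℝ EN HN}

theorem contMDiffAt_gap {f₁ f₂ : N → T.R} {y : N} (hf₁ : ContMDiffAt I 𝓘(ℝ, ER) ∞ f₁ y)
    (hf₂ : ContMDiffAt I 𝓘(ℝ, ER) ∞ f₂ y)
    (h : ∀ᶠ x in nhds y, π (T.σ (f₁ x)) = π (T.σ (f₂ x))) :
    ContMDiffAt I 𝓘(ℝ, EB) ∞ (fun x => T.gap (f₁ x) (f₂ x)) y := by
  obtain ⟨γ, hγ, hγe⟩ := T.exists_gap_extension h.self_of_nhds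
  have hf : ContMDiffAt I (𝓘(ℝ, ER).prod 𝓘(ℝ, ER)) ∞ (fun x => (f₁ x, f₂ x)) y :=
    hf₁.prodMk hf₂
  refine (ContMDiffAt.comp (g := γ) (f := fun x => (f₁ x, f₂ x)) y hγ hf).congr_of_eventuallyEq ?_
  filter_upwards [h, hf.continuousAt.tendsto.eventually hγe] with x hx hx' using (hx' hx).symm

/-- The equation `pr₂^* ω^σ - pr₁^* ω^σ = ψ^* ω^{Q_P}`, pulled back along a smooth map
`(f₁, f₂)` to `R ×_X R`. -/
theorem connection_along [LieGroup 𝓘(ℝ, EB) ∞ B] [FiniteDimensional ℝ EB] {f₁ f₂ : N → T.R} {b : N → B} {y : N}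
    (hf₁ : ContMDiffAt I 𝓘(ℝ, ER) ∞ f₁ y) (hf₂ : ContMDiffAt I 𝓘(ℝ, ER) ∞ f₂ y)
    (h : ∀ᶠ x in nhds y, π (T.σ (f₁ x)) = π (T.σ (f₂ x)) ∧ T.gap (f₁ x) (f₂ x) = b x) (w : EN) :
    T.ωσ.onModel (f₂ y) (modelDeriv I 𝓘(ℝ, ER) f₂ y w)
        - T.ωσ.onModel (f₁ y) (modelDeriv I 𝓘(ℝ, ER) f₁ y w)
      = S.modelT (modelMaurerCartan EB (b y) (modelDeriv I 𝓘(ℝ, EB) b y w)) := by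
  have hz : (f₁ y, f₂ y) ∈ FibreSquare (π ∘ T.σ) := h.self_of_nhds.1
  obtain ⟨g, hg⟩ := T.smooth_ψ ⟨(f₁ y, f₂ y), hz⟩
  obtain ⟨U, hU, hzU, hgU, hgψ⟩ := id hg
  have hgz := hgU.contMDiffAt (hU.mem_nhds hzU)
  have hγ : ContMDiffAt (𝓘(ℝ, ER).prod 𝓘(ℝ, ER)) 𝓘(ℝ, EB) ∞ (fun w => (g w).2.2) (f₁ y, f₂ y) :=
    contMDiffAt_snd.comp (f := fun w => (g w).2) _ (contMDiffAt_snd.comp (f := g) _ hgz)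
  have hf : ContMDiffAt I (𝓘(ℝ, ER).prod 𝓘(ℝ, ER)) ∞ (fun x => (f₁ x, f₂ x)) y :=
    hf₁.prodMk hf₂
  have hb : (fun x => (g (f₁ x, f₂ x)).2.2) =ᶠ[nhds y] b := by
    filter_upwards [h, hf.continuousAt.tendsto.eventually (hU.mem_nhds hzU)] with x hx hx'
    have hxm : (f₁ x, f₂ x) ∈ FibreSquare (π ∘ T.σ) := hx.1
    rw [hgψ ⟨_, hxm⟩ hx', ← hx.2, T.gap_eq hxm]
    rfl
  set v : ER × ER := (modelDeriv I 𝓘(ℝ, ER) f₁ y w, modelDeriv I 𝓘(ℝ, ER) f₂ y w) with hv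
  have hvf : modelDeriv I (𝓘(ℝ, ER).prod 𝓘(ℝ, ER)) (fun x => (f₁ x, f₂ x)) y w = v :=
    modelDeriv_prodMk hf₁ hf₂ w
  have s1 : ContMDiffAt (𝓘(ℝ, ER).prod 𝓘(ℝ, ER)) 𝓘(ℝ, EX) ∞
      (fun w : T.R × T.R => (π ∘ T.σ) w.1) (f₁ y, f₂ y) :=
    (T.contMDiff_proj _).comp (f := Prod.fst) _ contMDiffAt_fst
  have s2 : ContMDiffAt (𝓘(ℝ, ER).prod 𝓘(ℝ, ER)) 𝓘(ℝ, EX) ∞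
      (fun w : T.R × T.R => (π ∘ T.σ) w.2) (f₁ y, f₂ y) :=
    (T.contMDiff_proj _).comp (f := Prod.snd) _ contMDiffAt_snd
  have hvt : modelDeriv (𝓘(ℝ, ER).prod 𝓘(ℝ, ER)) 𝓘(ℝ, EX)
        (fun w : T.R × T.R => (π ∘ T.σ) w.1) (f₁ y, f₂ y) v
      = modelDeriv (𝓘(ℝ, ER).prod 𝓘(ℝ, ER)) 𝓘(ℝ, EX)
        (fun w : T.R × T.R => (π ∘ T.σ) w.2) (f₁ y, f₂ y) v := by
    rw [← hvf, ← modelDeriv_comp (g := fun w : T.R × T.R => (π ∘ T.σ) w.1)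
        (f := fun x => (f₁ x, f₂ x)) s1 hf,
      ← modelDeriv_comp (g := fun w : T.R × T.R => (π ∘ T.σ) w.2)
        (f := fun x => (f₁ x, f₂ x)) s2 hf]
    refine congrArg (fun D : EN →L[ℝ] EX => D w) (modelDeriv_congr ?_)
    filter_upwards [h] with x hx using hx.1
  have key := T.connection_eq ⟨(f₁ y, f₂ y), hz⟩ g hg v hvt
  rw [mfderiv_fst, mfderiv_snd] at key
  have e := modelDeriv_comp (g := fun w => (g w).2.2) (f := fun x => (f₁ x, f₂ x)) hγ hf w
  rw [modelDeriv_congr hb, hvf] at e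
  have hby : (g (f₁ y, f₂ y)).2.2 = b y := hb.self_of_nhds
  rw [e, ← hby]
  exact key.trans (differenceForm_pullback S hgz v)

section ConnectionForm

variable [IsManifold 𝓘(ℝ, EP) ∞ P]

/-- The connection form `α_* ω^σ + s(σ^* ω^π)`. -/
noncomputable def bForm (ωπ : GConnection G EC C EP P) (r : T.R) : ER →L[ℝ] EB :=
  𝓔.modelα.comp (T.ωσ.onModel r)
    + S.modelS.comp ((ωπ.onModel (T.σ r)).comp (modelDeriv 𝓘(ℝ, ER) 𝓘(ℝ, EP) T.σ r))

theorem bForm_apply (ωπ : GConnection G EC C EP P) (r : T.R) (v : ER) :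
    T.bForm ωπ r v = 𝓔.modelα (T.ωσ.onModel r v)
      + S.modelS (ωπ.onModel (T.σ r) (modelDeriv 𝓘(ℝ, ER) 𝓘(ℝ, EP) T.σ r v)) :=
  rfl

theorem contMDiff_bForm (ωπ : GConnection G EC C EP P) :
    ContMDiff 𝓘(ℝ, ER).tangent 𝓘(ℝ, EB) ∞
      (fun v : TangentBundle 𝓘(ℝ, ER) T.R => T.bForm ωπ v.1 v.2) :=
  (𝓔.modelα.contMDiff.comp T.ωσ.smooth_onModel).add
    (S.modelS.contMDiff.comp (ωπ.smooth_onModel.comp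
      (T.contMDiff_σ.contMDiff_tangentMap (m := ∞) (by simp))))

theorem bForm_smul (ωπ : GConnection G EC C EP P) (g : G) (r : T.R) (v : ER) :
    T.bForm ωπ (g • r) (modelDeriv 𝓘(ℝ, ER) 𝓘(ℝ, ER) (fun q : T.R => g • q) r v)
      = T.bForm ωπ r v := by
  have h3 := modelDeriv_comp (g := T.σ) (f := fun q : T.R => g • q) (x := r)
    (T.contMDiff_σ _) (T.isBundle.contMDiff_smul_left g _) v
  have h4 := modelDeriv_comp (g := fun p : P => g • p) (f := T.σ) (x := r)
    (hπ.contMDiff_smul_left g _) (T.contMDiff_σ _) v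
  rw [funext (fun q => T.isBundle.map_smul g q), h4] at h3
  rw [bForm_apply, bForm_apply, ← h3, T.ωσ.onModel_smul, T.isBundle.map_smul, ωπ.onModel_smul]

theorem modelβ_bForm (ωπ : GConnection G EC C EP P) (r : T.R) (v : ER) :
    𝓔.modelβ (T.bForm ωπ r v)
      = ωπ.onModel (T.σ r) (modelDeriv 𝓘(ℝ, ER) 𝓘(ℝ, EP) T.σ r v) := by
  rw [bForm_apply, map_add, modelβ_modelα, S.modelβ_modelS, zero_add]

end ConnectionForm

variable [LieGroup 𝓘(ℝ, EA) ∞ A] [LieGroup 𝓘(ℝ, EB) ∞ B]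

/-- `B` acts smoothly: near a given point, `r b = τ(σ(r) β(b)) a` for a local section `τ` of
`σ : R → P`, where `α(a)` is the difference between `b` and the `B`-component of
`ψ[r, τ(σ(r) β(b))]`. -/
theorem contMDiff_translate : ContMDiff (𝓘(ℝ, ER).prod 𝓘(ℝ, EB)) 𝓘(ℝ, ER) ∞
    (fun z : T.R × B => T.translate z.1 z.2) := by
  intro z₀
  have hσ := T.isBundle.isPrincipalBundle
  obtain ⟨U, κ, τ, hx, g⟩ := hσ.exists_gauge (T.σ z₀.1 <• 𝓔.β z₀.2)
  obtain ⟨l, hl, hls⟩ := 𝓔.exists_smooth_leftInverse_α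
  have sp : ContMDiff (𝓘(ℝ, ER).prod 𝓘(ℝ, EB)) 𝓘(ℝ, EP) ∞
      (fun z : T.R × B => T.σ z.1 <• 𝓔.β z.2) :=
    hπ.isPrincipalBundle.contMDiff_act.comp (g := fun z : P × C => z.1 <• z.2)
      (f := fun z : T.R × B => (T.σ z.1, 𝓔.β z.2))
      ((T.contMDiff_σ.comp contMDiff_fst).prodMk (𝓔.contMDiff_β.comp contMDiff_snd))
  have hU : ∀ᶠ z : T.R × B in nhds z₀, T.σ z.1 <• 𝓔.β z.2 ∈ U :=
    sp.continuous.continuousAt.eventually (g.isOpen.mem_nhds hx)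
  set f : T.R × B → T.R := fun z => τ (T.σ z.1 <• 𝓔.β z.2) with hf
  have sf : ContMDiffAt (𝓘(ℝ, ER).prod 𝓘(ℝ, EB)) 𝓘(ℝ, ER) ∞ f z₀ :=
    ContMDiffAt.comp (g := τ) (f := fun z : T.R × B => T.σ z.1 <• 𝓔.β z.2) z₀
      (g.smooth_section _ hx) (sp z₀)
  have hf1 : ∀ z : T.R × B, T.σ z.1 <• 𝓔.β z.2 ∈ U → T.σ (f z) = T.σ z.1 <• 𝓔.β z.2 :=
    fun z hz => g.proj_section _ hz
  have hf2 : ∀ z : T.R × B, T.σ z.1 <• 𝓔.β z.2 ∈ U → π (T.σ z.1) = π (T.σ (f z)) :=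
    fun z hz => by rw [hf1 z hz, hπ.isPrincipalBundle.map_act]
  have ha : ∀ z : T.R × B, T.σ z.1 <• 𝓔.β z.2 ∈ U →
      ∃ a, 𝓔.α a = (T.gap z.1 (f z))⁻¹ * z.2 ∧ T.translate z.1 z.2 = f z <• a := fun z hz => by
    obtain ⟨a, ha⟩ := 𝓔.exists_mul_α_eq
      (hπ.isPrincipalBundle.act_injective _ ((T.σ_gap (hf2 z hz)).trans (hf1 z hz)))
    exact ⟨a, by rw [← ha, inv_mul_cancel_left],
      T.translate_eq (by rw [T.σ_act]; exact hf2 z hz) (by rw [T.gap_act (hf2 z hz), ha])⟩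
  have sgap := T.contMDiffAt_gap (f₁ := fun z : T.R × B => z.1) contMDiffAt_fst sf
    (hU.mono hf2)
  have sl : ContMDiffAt (𝓘(ℝ, ER).prod 𝓘(ℝ, EB)) 𝓘(ℝ, EA) ∞
      (fun z : T.R × B => l ((T.gap z.1 (f z))⁻¹ * z.2)) z₀ := by
    obtain ⟨a, ha, -⟩ := ha z₀ hx
    exact ContMDiffAt.comp (g := l) (f := fun z : T.R × B => (T.gap z.1 (f z))⁻¹ * z.2) z₀
      (ha ▸ hls a) (sgap.inv.mul contMDiffAt_snd)
  refine (ContMDiffAt.comp (g := fun y : T.R × A => y.1 <• y.2)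
    (f := fun z => (f z, l ((T.gap z.1 (f z))⁻¹ * z.2))) z₀ (hσ.contMDiff_act _)
    (sf.prodMk sl)).congr_of_eventuallyEq ?_
  filter_upwards [hU] with z hz
  obtain ⟨a, ha, hz'⟩ := ha z hz
  rw [hz']
  simp only [Function.comp_apply, ← ha, hl]

/-- The composite `R → P → X` is a principal `B`-bundle: local sections of `P → X` and of `R → P`
compose to a local section, whose coordinate function is given by `gap`. -/
theorem isPrincipalBundle_proj :
    letI := T.actionB
    IsPrincipalBundle EB B ER T.R EX X (π ∘ T.σ) := by
  let _ := T.actionB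
  have hB : ∀ (r : T.R) (b : B), r <• b = T.translate r b := fun _ _ => rfl
  refine IsPrincipalBundle.of_gauges T.contMDiff_translate T.proj_translate T.contMDiff_proj
    (fun x => ?_)
  have hσ := T.isBundle.isPrincipalBundle
  obtain ⟨U, κP, τP, hxU, gP⟩ := hπ.isPrincipalBundle.exists_gauge x
  obtain ⟨W, κσ, τσ, hxW, gσ⟩ := hσ.exists_gauge (τP x)
  have hUW : IsOpen (U ∩ τP ⁻¹' W) := ContinuousOn.isOpen_inter_preimage
    (fun y hy => (gP.smooth_section y hy).continuousAt.continuousWithinAt) gP.isOpen gσ.isOpen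
  have hτ : ∀ y ∈ U ∩ τP ⁻¹' W, π (T.σ (τσ (τP y))) = y := fun y hy => by
    rw [gσ.proj_section _ hy.2, gP.proj_section _ hy.1]
  have sτ : ∀ y ∈ U ∩ τP ⁻¹' W, ContMDiffAt 𝓘(ℝ, EX) 𝓘(ℝ, ER) ∞ (fun y => τσ (τP y)) y :=
    fun y hy => (gσ.smooth_section _ hy.2).comp y (gP.smooth_section y hy.1)
  refine ⟨U ∩ τP ⁻¹' W, fun r => T.gap (τσ (τP (π (T.σ r)))) r, fun y => τσ (τP y), ⟨hxU, hxW⟩,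
    hUW, fun r hr => ?_, sτ, hτ, fun y hy => ?_, fun r hr b => ?_, fun r hr => ?_⟩
  · refine T.contMDiffAt_gap (f₂ := fun r => r) ((sτ _ hr).comp r (T.contMDiff_proj r))
      contMDiffAt_id ?_
    filter_upwards [T.contMDiff_proj.continuous.continuousAt.preimage_mem_nhds
      (hUW.mem_nhds hr)] with q hq using hτ _ hq
  · simp only [hτ y hy, T.gap_self]
  · simp only [hB, T.proj_translate]
    rw [← T.gap_mul (r₂ := r) (hτ _ hr) (T.proj_translate r b).symm, T.gap_translate]
  · exact T.translate_eq (hτ _ hr) rfl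

variable [FiniteDimensional ℝ EB] [IsManifold 𝓘(ℝ, EP) ∞ P]

/-- Along the curves `(r, r b)` in `R ×_X R` the map `ψ` is `b`, so `ω^σ` is `t` on vertical vectors. -/
theorem bForm_vertical (ωπ : GConnection G EC C EP P) (r : T.R) (ξ : EB) :
    T.bForm ωπ r (modelDeriv 𝓘(ℝ, EB) 𝓘(ℝ, ER) (fun b : B => T.translate r b) 1 ξ) = ξ := by
  let _ := T.actionB
  have hR := T.isPrincipalBundle_proj
  have hP := hπ.isPrincipalBundle
  have sr : ContMDiff 𝓘(ℝ, EB) 𝓘(ℝ, ER) ∞ (fun b : B => T.translate r b) := hR.contMDiff_orbit r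
  have hr1 : T.translate r 1 = r := T.translate_eq rfl (T.gap_self r)
  have h1 := T.connection_along (I := 𝓘(ℝ, EB)) (f₁ := fun _ : B => r)
    (f₂ := fun b : B => T.translate r b) (b := fun b => b) (y := 1) contMDiffAt_const (sr _)
    (Filter.Eventually.of_forall fun b => ⟨(T.proj_translate r b).symm, T.gap_translate r b⟩) ξ
  rw [modelDeriv_const, map_zero, sub_zero, hr1, modelDeriv_id, modelMaurerCartan] at h1
  simp only [inv_one, one_mul] at h1
  rw [modelDeriv_id] at h1
  have h3 := modelDeriv_comp (g := T.σ) (f := fun b : B => T.translate r b) (x := 1)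
    (T.contMDiff_σ _) (sr _) ξ
  have h4 : _ = modelDeriv 𝓘(ℝ, EC) 𝓘(ℝ, EP) (fun c : C => T.σ r <• c) (𝓔.β 1) (𝓔.modelβ ξ) :=
    modelDeriv_comp (g := fun c : C => T.σ r <• c) (f := 𝓔.β) (x := 1)
      (hP.contMDiff_orbit _ _) (𝓔.contMDiff_β _) ξ
  rw [funext (T.σ_translate r), h4, hr1, map_one] at h3
  rw [bForm_apply, h1, ← h3, ωπ.onModel_vertical, S.modelα_modelT]

/-- Along the maps `r ↦ (r, r b)` to `R ×_X R` the map `ψ` is constant, so `ω^σ` is `B`-invariant. -/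
theorem bForm_act [LieGroup 𝓘(ℝ, EC) ∞ C] (ωπ : GConnection G EC C EP P) (r : T.R) (b : B) (v : ER) :
    T.bForm ωπ (T.translate r b)
        (modelDeriv 𝓘(ℝ, ER) 𝓘(ℝ, ER) (fun q : T.R => T.translate q b) r v)
      = modelAd EB b⁻¹ (T.bForm ωπ r v) := by
  let _ := T.actionB
  have hR := T.isPrincipalBundle_proj
  have hP := hπ.isPrincipalBundle
  have sb : ContMDiff 𝓘(ℝ, ER) 𝓘(ℝ, ER) ∞ (fun q : T.R => T.translate q b) :=
    hR.contMDiff_act_right b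
  have h1 := T.connection_along (I := 𝓘(ℝ, ER)) (f₁ := fun q : T.R => q)
    (f₂ := fun q : T.R => T.translate q b) (b := fun _ => b) (y := r) contMDiffAt_id (sb _)
    (Filter.Eventually.of_forall fun q => ⟨(T.proj_translate q b).symm, T.gap_translate q b⟩) v
  rw [modelDeriv_const, map_zero, map_zero, modelDeriv_id, sub_eq_zero] at h1
  have h3 := modelDeriv_comp (g := T.σ) (f := fun q : T.R => T.translate q b) (x := r)
    (T.contMDiff_σ _) (sb _) v
  have h4 := modelDeriv_comp (g := fun p : P => p <• 𝓔.β b) (f := T.σ) (x := r)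
    (hP.contMDiff_act_right _ _) (T.contMDiff_σ _) v
  rw [funext (fun q => T.σ_translate q b), h4] at h3
  rw [bForm_apply, bForm_apply, h1, ← h3, T.σ_translate, ωπ.onModel_act, map_add,
    modelAd_modelα, ← map_inv, S.modelS_modelAd]

/-- The central extension of a triple, on the same total space. -/
noncomputable def toExtension [LieGroup 𝓘(ℝ, EC) ∞ C] (ωπ : GConnection G EC C EP P) :
    AdmissibleExtension.{u} ER 𝓔 hπ ωπ :=
  letI := T.actionB
  { R := T.R
    ρ := π ∘ T.σ
    isBundle :=
      { isPrincipalBundle := T.isPrincipalBundle_proj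
        contMDiff_smul := T.isBundle.contMDiff_smul
        smul_act := T.smul_translate
        map_smul := fun g r => (congrArg π (T.isBundle.map_smul g r)).trans (hπ.map_smul _ _) }
    σ := T.σ
    contMDiff_σ := T.contMDiff_σ
    σ_act := T.σ_translate
    σ_smul := T.isBundle.map_smul
    π_σ := fun _ => rfl
    ωρ := GConnection.ofModel (T.bForm ωπ) (T.contMDiff_bForm ωπ) (T.bForm_vertical ωπ)
      (T.bForm_act ωπ) (T.bForm_smul ωπ)
    admissible := T.modelβ_bForm ωπ }

end Smoothness

end DescentTriple

/-! ### Existence and uniqueness of corresponding objects -/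

section Correspondence

open LieCentralExtension

universe u

variable {EG G EA A EB B EC C EX X EP P ER : Type*}
  [NormedAddCommGroup EG] [NormedSpace ℝ EG] [TopologicalSpace G] [ChartedSpace EG G] [Group G]
  [NormedAddCommGroup EA] [NormedSpace ℝ EA] [TopologicalSpace A] [ChartedSpace EA A] [CommGroup A]
  [NormedAddCommGroup EB] [NormedSpace ℝ EB] [TopologicalSpace B] [ChartedSpace EB B] [Group B]
  [NormedAddCommGroup EC] [NormedSpace ℝ EC] [TopologicalSpace C] [ChartedSpace EC C] [Group C]
  [NormedAddCommGroup EX] [NormedSpace ℝ EX] [TopologicalSpace X] [ChartedSpace EX X]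
  [NormedAddCommGroup EP] [NormedSpace ℝ EP] [TopologicalSpace P] [ChartedSpace EP P]
  [IsManifold 𝓘(ℝ, EP) ∞ P]
  [MulAction Cᵐᵒᵖ P] [MulAction G X] [MulAction G P]
  [NormedAddCommGroup ER] [NormedSpace ℝ ER]
  {𝓔 : LieCentralExtension EA A EB B EC C} {S : 𝓔.AdSplitting}
  {π : P → X} {hπ : IsEquivariantBundle EG G EC C EP P EX X π} {ωπ : GConnection G EC C EP P}

theorem Corresponds.of_equiv_left {E E' : AdmissibleExtension.{u} ER 𝓔 hπ ωπ}
    {T : DescentTriple.{u} ER S hπ} (hE : E ≈ E') (h : Corresponds E' T) : Corresponds E T := by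
  obtain ⟨Φ, hB, hG, hσ, hω⟩ := hE
  obtain ⟨Ψ, hA', hG', hσ', hω', hψ'⟩ := h
  refine ⟨Φ.trans Ψ, fun r a => ?_, fun g r => ?_, fun r => ?_, ?_, fun r₁ r₂ h => ?_⟩
  · simp [hB, hA']
  · simp [hG, hG']
  · simp [hσ, hσ']
  · exact PullsBackTo.trans (η' := fun r v => S.t (E'.ωρ.form r v))
      (fun r v => congrArg S.t (hω r v)) hω'
  · exact Φ.injective ((hB _ _).trans (hψ' (Φ r₁) (Φ r₂) h))

theorem Corresponds.of_equiv_right {E : AdmissibleExtension.{u} ER 𝓔 hπ ωπ}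
    {T T' : DescentTriple.{u} ER S hπ} (hT : T ≈ T') (h : Corresponds E T) : Corresponds E T' := by
  obtain ⟨Ψ, hA', hG', hσ', hω', hψ'⟩ := hT
  obtain ⟨Φ, hA, hG, hσ, hω, hψ⟩ := h
  refine ⟨Φ.trans Ψ, fun r a => ?_, fun g r => ?_, fun r => ?_, hω.trans hω', fun r₁ r₂ h => ?_⟩
  · simp [hA, hA']
  · simp [hG, hG']
  · simp [hσ, hσ']
  · have h' : (Φ r₁, Φ r₂) ∈ FibreSquare (π ∘ T.σ) := by
      have h : π (T'.σ (Ψ (Φ r₁))) = π (T'.σ (Ψ (Φ r₂))) := h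
      rw [hσ', hσ'] at h
      exact h
    have e := hψ' (Φ r₁) (Φ r₂) h' h
    have e' := hψ r₁ r₂ h'
    rw [← e] at e'
    exact e'

/-- Two triples of the same extension are isomorphic: their maps `ψ` are both determined by the
`B`-action, which is free. -/
theorem Corresponds.equiv_right {E : AdmissibleExtension.{u} ER 𝓔 hπ ωπ}
    {T T' : DescentTriple.{u} ER S hπ} (h : Corresponds E T) (h' : Corresponds E T') : T ≈ T' := by
  obtain ⟨Φ, hA, hG, hσ, hω, hψ⟩ := h
  obtain ⟨Φ', hA', hG', hσ', hω', hψ'⟩ := h'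
  have hσσ : ∀ r : T.R, T'.σ (Φ' (Φ.symm r)) = T.σ r := fun r => by
    rw [hσ', ← hσ, Diffeomorph.apply_symm_apply]
  refine ⟨Φ.symm.trans Φ', fun r a => ?_, fun g r => ?_, hσσ, hω.symm.trans hω',
    fun r₁ r₂ h h' => ?_⟩
  · obtain ⟨x, rfl⟩ : ∃ x, Φ x = r := Φ.surjective r
    rw [← hA]
    simp [hA']
  · obtain ⟨x, rfl⟩ : ∃ x, Φ x = r := Φ.surjective r
    rw [← hG]
    simp [hG']
  · obtain ⟨x₁, rfl⟩ := Φ.surjective r₁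
    obtain ⟨x₂, rfl⟩ := Φ.surjective r₂
    refine DifferenceBundle.ext ?_ ?_ ?_
    · rw [T.ψ_fst, T'.ψ_fst]
      exact hσσ _
    · rw [T.ψ_snd, T'.ψ_snd]
      exact hσσ _
    · -- `x₁`, `x₂` are generalized because `Φ.symm (Φ xᵢ)` is `xᵢ` only propositionally
      have e : ∀ y₁ y₂ : E.R, y₁ = x₁ → y₂ = x₂ → ∀ hy : (Φ' y₁, Φ' y₂) ∈ FibreSquare (π ∘ T'.σ),
          (T'.ψ (BorelSquare.mk A ⟨_, hy⟩)).b = (T.ψ (BorelSquare.mk A ⟨_, h⟩)).b := by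
        rintro _ _ rfl rfl hy
        exact E.isPrincipalBundle.act_injective _ ((hψ' _ _ hy).trans (hψ _ _ h).symm)
      exact e _ _ (Φ.symm_apply_apply x₁) (Φ.symm_apply_apply x₂) h'

variable [LieGroup 𝓘(ℝ, EA) ∞ A] [FiniteDimensional ℝ EB]

/-- Two extensions with the same triple are isomorphic: the `B`-action is determined by `ψ`, and
`ω^ρ = α_* t(ω^ρ) + s β_*(ω^ρ)` is determined by `ω^σ` and `ω^π`. -/
theorem Corresponds.equiv_left {E E' : AdmissibleExtension.{u} ER 𝓔 hπ ωπ}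
    {T : DescentTriple.{u} ER S hπ} (h : Corresponds E T) (h' : Corresponds E' T) : E ≈ E' := by
  obtain ⟨Φ, hA, hG, hσ, hω, hψ⟩ := h
  obtain ⟨Φ', hA', hG', hσ', hω', hψ'⟩ := h'
  have hσσ : ∀ r : E.R, E'.σ (Φ'.symm (Φ r)) = E.σ r := fun r => by
    rw [← hσ', ← hσ, Diffeomorph.apply_symm_apply]
  refine ⟨Φ.trans Φ'.symm, fun r b => ?_, fun g r => ?_, hσσ, fun r (v : ER) => ?_⟩
  · have hm : (Φ r, Φ (r <• b)) ∈ FibreSquare (π ∘ T.σ) := by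
      change π (T.σ (Φ r)) = π (T.σ (Φ (r <• b)))
      rw [hσ, hσ]
      exact (E.isPrincipalBundle.map_act r b).symm
    have e1 := E.isPrincipalBundle.act_injective _ (hψ r (r <• b) hm)
    have e2 : ∀ y₁ y₂ : T.R, y₁ = Φ r → y₂ = Φ (r <• b) →
        ∀ hy : (y₁, y₂) ∈ FibreSquare (π ∘ T.σ), (T.ψ (BorelSquare.mk A ⟨_, hy⟩)).b = b := by
      rintro _ _ rfl rfl hy
      exact e1
    have hy₁ : Φ' (Φ'.symm (Φ r)) = Φ r := Φ'.apply_symm_apply _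
    have hy₂ : Φ' (Φ'.symm (Φ (r <• b))) = Φ (r <• b) := Φ'.apply_symm_apply _
    have hy : (Φ' (Φ'.symm (Φ r)), Φ' (Φ'.symm (Φ (r <• b)))) ∈ FibreSquare (π ∘ T.σ) := by
      rw [hy₁, hy₂]
      exact hm
    have e3 := hψ' _ _ hy
    rw [e2 _ _ hy₁ hy₂ hy] at e3
    exact e3.symm
  · apply Φ'.injective
    simp [hG, hG']
  · -- both `t(ω^ρ)` and `β_*(ω^ρ)` are preserved
    have ht := hω.trans hω'.symm r v
    set Ψ : E.R ≃ₘ^∞⟮𝓘(ℝ, ER), 𝓘(ℝ, ER)⟯ E'.R := Φ.trans Φ'.symm with hΨ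
    have ht' : S.modelT (E'.ωρ.onModel (Ψ r) (modelDeriv 𝓘(ℝ, ER) 𝓘(ℝ, ER) Ψ r v))
        = S.modelT (E.ωρ.onModel r v) := ht
    have hσ2 : (fun x => E'.σ (Ψ x)) = E.σ := funext hσσ
    have hβ : 𝓔.modelβ (E'.ωρ.onModel (Ψ r) (modelDeriv 𝓘(ℝ, ER) 𝓘(ℝ, ER) Ψ r v))
        = 𝓔.modelβ (E.ωρ.onModel r v) := by
      rw [E'.modelβ_onModel, E.modelβ_onModel,
        ← modelDeriv_comp (g := E'.σ) (f := Ψ) (E'.contMDiff_σ _) (Ψ.contMDiff _), hσ2,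
        show E'.σ (Ψ r) = E.σ r from hσσ r]
    have e1 := S.modelα_modelT (E'.ωρ.onModel (Ψ r) (modelDeriv 𝓘(ℝ, ER) 𝓘(ℝ, ER) Ψ r v))
    rw [ht', hβ, S.modelα_modelT] at e1
    exact e1.symm

variable [LieGroup 𝓘(ℝ, EB) ∞ B] [LieGroup 𝓘(ℝ, EC) ∞ C]

theorem AdmissibleExtension.corresponds_toTriple (E : AdmissibleExtension.{u} ER 𝓔 hπ ωπ) :
    Corresponds E (E.toTriple S) :=
  ⟨Diffeomorph.refl _ _ _, fun _ _ => rfl, fun _ _ => rfl, fun _ => rfl,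
    PullsBackTo.refl, fun r₁ r₂ h => E.act_difference ⟨(r₁, r₂), h⟩⟩

theorem DescentTriple.corresponds_toExtension (T : DescentTriple.{u} ER S hπ) :
    Corresponds (T.toExtension ωπ) T := by
  have ht : ∀ (r : T.R) (v : ER), S.modelT (T.bForm ωπ r v) = T.ωσ.onModel r v := fun r v => by
    rw [bForm_apply, map_add, S.modelT_modelα, S.modelT_modelS, add_zero]
  refine ⟨Diffeomorph.refl _ _ _, T.translate_α, fun _ _ => rfl, fun _ => rfl, fun r v => ?_,
    fun r₁ r₂ h => T.translate_eq h (T.gap_eq h)⟩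
  refine (PullsBackTo.refl (η := fun r v => T.ωσ.form r v) r v).trans (ht r v).symm

end Correspondence

theorem theorem3
    {EG G EA A EB B EC C EX X EP P ER : Type*}
    -- the Lie group `G`
    [NormedAddCommGroup EG] [NormedSpace ℝ EG] [FiniteDimensional ℝ EG]
    [TopologicalSpace G] [ChartedSpace EG G] [Group G] [LieGroup 𝓘(ℝ, EG) ∞ G]
    -- the central extension of Lie groups `1 → A → B → C → 1`
    [NormedAddCommGroup EA] [NormedSpace ℝ EA] [FiniteDimensional ℝ EA]
    [TopologicalSpace A] [ChartedSpace EA A] [CommGroup A] [LieGroup 𝓘(ℝ, EA) ∞ A]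
    [NormedAddCommGroup EB] [NormedSpace ℝ EB] [FiniteDimensional ℝ EB]
    [TopologicalSpace B] [ChartedSpace EB B] [Group B] [LieGroup 𝓘(ℝ, EB) ∞ B]
    [NormedAddCommGroup EC] [NormedSpace ℝ EC] [FiniteDimensional ℝ EC]
    [TopologicalSpace C] [ChartedSpace EC C] [Group C] [LieGroup 𝓘(ℝ, EC) ∞ C]
    (𝓔 : LieCentralExtension EA A EB B EC C)
    -- the `Ad|_B`-equivariant splitting
    (S : 𝓔.AdSplitting)
    -- the `G`-manifold `X`
    [NormedAddCommGroup EX] [NormedSpace ℝ EX] [FiniteDimensional ℝ EX]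
    [TopologicalSpace X] [ChartedSpace EX X] [IsManifold 𝓘(ℝ, EX) ∞ X]
    [MulAction G X] [ContMDiffSMul 𝓘(ℝ, EG) 𝓘(ℝ, EX) ∞ G X]
    -- the `G`-equivariant `C`-bundle `π : P → X` with its `G`-equivariant connection
    [NormedAddCommGroup EP] [NormedSpace ℝ EP] [FiniteDimensional ℝ EP]
    [TopologicalSpace P] [ChartedSpace EP P] [IsManifold 𝓘(ℝ, EP) ∞ P]
    [MulAction Cᵐᵒᵖ P] [MulAction G P]
    (π : P → X) (hπ : IsEquivariantBundle EG G EC C EP P EX X π)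
    (ωπ : GConnection G EC C EP P)
    -- the model space of the total spaces `R`
    [NormedAddCommGroup ER] [NormedSpace ℝ ER] [FiniteDimensional ℝ ER] :
    ∃ e : Quotient (AdmissibleExtension.setoid (ER := ER) (𝓔 := 𝓔) (hπ := hπ) (ωπ := ωπ)) ≃
        Quotient (DescentTriple.setoid (ER := ER) (S := S) (hπ := hπ)),
      ∀ (E : AdmissibleExtension ER 𝓔 hπ ωπ) (T : DescentTriple ER S hπ),
        e (Quotient.mk _ E) = Quotient.mk _ T ↔ Corresponds E T := by
  refine ⟨
    { toFun := Quotient.map (fun E => E.toTriple S) fun E E' hE =>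
        E.corresponds_toTriple.equiv_right (E'.corresponds_toTriple.of_equiv_left hE)
      invFun := Quotient.map (fun T => T.toExtension ωπ) fun T T' hT =>
        (T.corresponds_toExtension.of_equiv_right hT).equiv_left T'.corresponds_toExtension
      left_inv := ?_
      right_inv := ?_ }, fun E T => ?_⟩
  · rintro ⟨E⟩
    exact Quotient.sound
      ((E.toTriple S).corresponds_toExtension.equiv_left E.corresponds_toTriple)
  · rintro ⟨T⟩
    exact Quotient.sound
      ((T.toExtension ωπ).corresponds_toTriple.equiv_right T.corresponds_toExtension)
  · refine ⟨fun h => ?_, fun h => Quotient.sound (E.corresponds_toTriple.equiv_right h)⟩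
    exact E.corresponds_toTriple.of_equiv_right (Quotient.exact h)
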